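/- Let $N\ge 2$, $K\ge 1$, $K_{\rm u}\ge 1$ be integers. Consider cache-aided multiuser private information retrieval (MuPIR) with $N$ replicated non-colluding databases, $K$ independent messages $W_1,\dots,W_K$, each uniformly distributed on the binary words of length $L\ge 1$, and $K_{\rm u}$ users with a demand vector $\boldsymbol\theta\in[K]^{K_{\rm u}}$ that is independent of the messages and has an arbitrary law with full support. A scheme (with finite alphabets and any $L$) consists of - caches $Z_u$, functions of $W_{1:K}$, of at most $ML$ bits each; - queries $Q_{1:N}$, generated jointly and at random from $\boldsymbol\theta$ and the caches in such a way that, for every $u$, their conditional law given $\boldsymbol\theta$ and $W_{1:K}$ depends only on $\boldsymbol\theta$ and $Z_u$ (so the queries do not tell a user what the others have stored); - answers $A_n$, functions of $Q_n$ and $W_{1:K}$. It is required that each user decodes her message, $H(W_{\theta_u}\mid \boldsymbol\theta,Q_{1:N},A_{1:N},Z_u)=0$ for all $u\in[K_{\rm u}]$, and that each database learns nothing about the demands, $I(\boldsymbol\theta;Q_n,A_n,W_{1:K},Z_{1:K_{\rm u}})=0$ for all $n\in[N]$. The load of the scheme is $\frac1L\sum_{n=1}^N H(A_n)$, with entropies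 in bits. Let $R^\star(M)$ be the infimum of the loads of all such schemes with cache size at most $ML$ bits. The Product Design (PD) with parameter $t\in\{0,\dots,K_{\rm u}\}$ uses $L=\binom{K_{\rm u}}{t}N^K$. Each message $W_k$ is split into packets $W_{k,\mathcal T}$ of $N^K$ bits, for $\mathcal T\subseteq[K_{\rm u}]$ with $|\mathcal T|=t$, and user $u$ caches all $W_{k,\mathcal T}$ with $u\in\mathcal T$. For each $\mathcal S\subseteq[K_{\rm u}]$ with $|\mathcal S|=t+1$, each database sends the sum over $u\in\mathcal S$ of its answers in the Sun--Jafar PIR scheme for the messages $W_{1,\mathcal S\setminus\{u\}},\dots,W_{K,\mathcal S\setminus\{u\}}$ with demand $\theta_u$, where all random bit permutations are independent and uniform. For general memory sizes, copies of the PD with different $t$ are run on independent parts of the messages (memory sharing). The corresponding load is $$R_{\rm PD}(M)=\min\Big\{K\big(1-\tfrac MK\big),\ \widehat R(M)\Big\},$$ where $\widehat R$ is the lower convex envelope of the points $\Big(\frac{tK}{K_{\rm u}},\ \frac{K_{\rm u}-t}{t+1}\big(1+\frac1N+\cdots+\frac1{N^{K-1}}\big)\Big)$, $t=0,\dots,K_{\rm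 u}$. Claim: if $\frac{K(K_{\rm u}-1)}{K_{\rm u}}\le M\le K$, then the Product Design is exactly optimal, that is, $$R^\star(M)=R_{\rm PD}(M)=\Big(1-\frac MK\Big)\Big(1+\frac1N+\cdots+\frac1{N^{K-1}}\Big),$$ and this load is attained by the PD with memory sharing: for rational $M$, some instance of it is a scheme as above with caches of exactly $ML$ bits and load exactly $R_{\rm PD}(M)$; for every real $M$ in the range and every $\varepsilon>0$, some instance is a scheme as above with caches of at most $ML$ bits and load at most $R_{\rm PD}(M)+\varepsilon$. -/

import Mathlib

open scoped BigOperators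

noncomputable section

namespace MuPIR

/-! ### Shannon entropy (in bits) of finite-valued random variables on a discrete space -/

/-- `H(X)` in bits, for a random variable `X` on the discrete probability space `(Ω, p)`. -/
def entropy {Ω α : Type} [Fintype α] (p : PMF Ω) (X : Ω → α) : ℝ :=
  (∑ x : α, Real.negMulLog ((p.map X) x).toReal) / Real.log 2

/-- `H(X | Y) = H(X, Y) - H(Y)`. -/
def condEntropy {Ω α β : Type} [Fintype α] [Fintype β] (p : PMF Ω)
    (X : Ω → α) (Y : Ω → β) : ℝ :=
  entropy p (fun ω => (X ω, Y ω)) - entropy p Y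

/-- `I(X; Y) = H(X) + H(Y) - H(X, Y)`. -/
def mutualInfo {Ω α β : Type} [Fintype α] [Fintype β] (p : PMF Ω)
    (X : Ω → α) (Y : Ω → β) : ℝ :=
  entropy p X + entropy p Y - entropy p (fun ω => (X ω, Y ω))

/-! ### The cache-aided multiuser PIR problem -/

/-- The library: `K` messages, each a binary word with positions in `Bit`. -/
abbrev Library (K : ℕ) (Bit : Type) : Type := Fin K → Bit → ZMod 2

/-- A demand vector: user `u` wants message `θ u`. -/
abbrev Demand (K Ku : ℕ) : Type := Fin Ku → Fin K

/-- The data of a scheme for `N` databases, `K` messages and `Ku` users.  The message length `L`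
is the number of elements of `Bit`.  The caches are functions of the library.  The `N` queries are
generated jointly, at random, from the demand vector and the caches.  Each answer is a
deterministic function of the query received and the library (of which the caches are
functions). -/
structure Scheme (N K Ku : ℕ) where
  Bit : Type
  Cache : Fin Ku → Type
  Query : Type
  Answer : Type
  [bitFintype : Fintype Bit]
  [bitDecEq : DecidableEq Bit]
  [cacheFintype : ∀ u, Fintype (Cache u)]
  [queryFintype : Fintype Query]
  [answerFintype : Fintype Answer]
  cache : (u : Fin Ku) → Library K Bit → Cache u
  query : Demand K Ku → ((u : Fin Ku) → Cache u) → PMF (Fin N → Query)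
  answer : Fin N → Query → Library K Bit → Answer

attribute [instance] Scheme.bitFintype Scheme.bitDecEq Scheme.cacheFintype
  Scheme.queryFintype Scheme.answerFintype

namespace Scheme

variable {N K Ku : ℕ} (S : Scheme N K Ku)

/-- The message length `L` in bits. -/
def length : ℕ := Fintype.card S.Bit

/-- The cache size of user `u` in bits, normalized by the message length. -/
def memory (u : Fin Ku) : ℝ := Real.logb 2 (Fintype.card (S.Cache u)) / S.length

/-- Outcomes: demand vector, library, vector of queries. -/
abbrev Outcome : Type := Demand K Ku × Library K S.Bit × (Fin N → S.Query)

/-- All caches, as a function of the library. -/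
def caches (W : Library K S.Bit) : (u : Fin Ku) → S.Cache u := fun u => S.cache u W

/-- The answer of database `n`, as a random variable. -/
def ans (n : Fin N) (ω : S.Outcome) : S.Answer := S.answer n (ω.2.2 n) ω.2.1

/-- The joint law: the demand vector has law `P`, the messages are independent of it, mutually
independent and uniform, and the queries are generated from the demands and the caches. -/
def law (P : PMF (Demand K Ku)) : PMF S.Outcome :=
  P.bind fun θ => (PMF.uniformOfFintype (Library K S.Bit)).bind fun W =>
    (S.query θ (S.caches W)).map fun q => (θ, W, q)

/-- Every user could generate the queries from the demand vector and her own cache: the queries do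
not convey to a user what is stored in the caches of the others. -/
def QueriesConsistent : Prop :=
  ∀ (θ : Demand K Ku) (u : Fin Ku) (W W' : Library K S.Bit),
    S.cache u W = S.cache u W' → S.query θ (S.caches W) = S.query θ (S.caches W')

/-- Every user recovers her message, without error, from the demand vector, all queries, all
answers and her cache. -/
def Decodable (P : PMF (Demand K Ku)) : Prop :=
  ∀ u : Fin Ku, condEntropy (S.law P) (fun ω => ω.2.1 (ω.1 u))
    (fun ω => (ω.1, ω.2.2, fun n => S.ans n ω, S.cache u ω.2.1)) = 0

/-- No database learns anything about the demand vector from its query, its answer, the library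
and the caches. -/
def Private (P : PMF (Demand K Ku)) : Prop :=
  ∀ n : Fin N, mutualInfo (S.law P) (fun ω => ω.1)
    (fun ω => (ω.2.2 n, S.ans n ω, ω.2.1, S.caches ω.2.1)) = 0

/-- The requirements on a scheme. -/
structure Valid (P : PMF (Demand K Ku)) : Prop where
  length_pos : 0 < S.length
  queries : S.QueriesConsistent
  decodable : S.Decodable P
  isPrivate : S.Private P

/-- The load: the total entropy of the answers, normalized by the message length. -/
def load (P : PMF (Demand K Ku)) : ℝ :=
  (∑ n : Fin N, entropy (S.law P) (S.ans n)) / S.length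

end Scheme

/-- The memory-load pair `(M, R)` is achieved by some scheme. -/
def Achievable (N : ℕ) {K Ku : ℕ} (P : PMF (Demand K Ku)) (M R : ℝ) : Prop :=
  ∃ S : Scheme N K Ku, S.Valid P ∧ (∀ u, S.memory u ≤ M) ∧ S.load P ≤ R

/-! ### The load of the product design -/

/-- `1 + 1/N + ⋯ + 1/N^(K-1)`. -/
def pirLoad (N K : ℕ) : ℝ := ∑ i ∈ Finset.range K, 1 / (N : ℝ) ^ i

/-- The load of the product design at the memory `t * K / Ku`. -/
def cornerLoad (N K Ku t : ℕ) : ℝ := ((Ku : ℝ) - t) / (t + 1) * pirLoad N K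

/-- The lower convex envelope of the corner points `(t * K / Ku, cornerLoad N K Ku t)`,
`t = 0, …, Ku`, at the memory `M`. -/
def envelopeLoad (N K Ku : ℕ) (M : ℝ) : ℝ :=
  sInf {R : ℝ | ∃ c ∈ stdSimplex ℝ (Fin (Ku + 1)),
    ∑ t, c t * (((t : ℕ) : ℝ) * K / Ku) = M ∧ ∑ t, c t * cornerLoad N K Ku t = R}

/-- The load `R_PD(M)` of the product design. -/
def productDesignLoad (N K Ku : ℕ) (M : ℝ) : ℝ :=
  min ((K : ℝ) * (1 - M / K)) (envelopeLoad N K Ku M)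

/-! ### The Sun-Jafar PIR scheme on messages of `N ^ K` bits -/

/-- Labels of the sums downloaded from a database: for every nonempty set `T` of messages,
there are `(N - 1) ^ (|T| - 1)` sums, each with one bit from each message in `T`. -/
abbrev SumLabel (N K : ℕ) : Type :=
  (T : {T : Finset (Fin K) // T.Nonempty}) × Fin ((N - 1) ^ (T.1.card - 1))

/-- The places (database, sum) for a bit of message `k`. -/
abbrev Slot (N K : ℕ) (k : Fin K) : Type :=
  {x : Fin N × SumLabel N K // k ∈ x.2.1.1}

theorem card_slot (N K : ℕ) (k : Fin K) : Fintype.card (Slot N K k) = N ^ K := by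
  classical
  rcases Nat.eq_zero_or_pos N with h | hN
  · subst h
    have hK : K ≠ 0 := fun h => by subst h; exact k.elim0
    rw [zero_pow hK, Fintype.card_eq_zero_iff]
    exact ⟨fun x => x.1.1.elim0⟩
  · have key : ∑ T : Finset (Fin K), (if k ∈ T then (N - 1) ^ (T.card - 1) else 0)
        = N ^ (K - 1) := by
      have h1 := Finset.sum_pow_mul_eq_add_pow (N - 1) 1 (Finset.univ.erase k)
      rw [Finset.card_erase_of_mem (Finset.mem_univ k), Finset.card_univ, Fintype.card_fin,
        Nat.sub_add_cancel hN] at h1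
      rw [← h1, ← Finset.sum_filter]
      refine Finset.sum_nbij' (fun T => T.erase k) (fun T => insert k T) ?_ ?_ ?_ ?_ ?_
      · intro T _
        simp [Finset.erase_subset_erase]
      · intro T _
        simp
      · intro T hT
        exact Finset.insert_erase (by simpa using hT)
      · intro T hT
        refine Finset.erase_insert fun hk => ?_
        have := Finset.mem_powerset.1 hT hk
        simp at this
      · intro T hT
        have hk : k ∈ T := by simpa using hT
        simp [Finset.card_erase_of_mem hk]
    have hcard : Fintype.card {l : SumLabel N K // k ∈ l.1.1} = N ^ (K - 1) := by
      rw [Fintype.card_subtype, Finset.card_filter, Fintype.sum_sigma, ← key]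
      have h2 : ∀ T : {T : Finset (Fin K) // T.Nonempty},
          ∑ _j : Fin ((N - 1) ^ (T.1.card - 1)), (if k ∈ T.1 then 1 else 0)
            = if k ∈ T.1 then (N - 1) ^ (T.1.card - 1) else 0 := by
        intro T
        split_ifs <;> simp
      rw [Finset.sum_congr rfl fun T _ => h2 T]
      rw [← Finset.sum_subtype (Finset.univ.filter fun T : Finset (Fin K) => T.Nonempty)
        (by simp) (fun T => if k ∈ T then (N - 1) ^ (T.card - 1) else 0)]
      refine Finset.sum_subset (Finset.filter_subset _ _) fun T _ hT => ?_
      exact if_neg fun hk => hT (by simpa using ⟨k, hk⟩)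
    have e : Slot N K k ≃ Fin N × {l : SumLabel N K // k ∈ l.1.1} :=
      { toFun := fun x => (x.1.1, ⟨x.1.2, x.2⟩)
        invFun := fun y => ⟨(y.1, y.2.1), y.2.2⟩
        left_inv := fun _ => rfl
        right_inv := fun _ => rfl }
    rw [Fintype.card_congr e, Fintype.card_prod, hcard, Fintype.card_fin, ← pow_succ']
    congr 1
    have := k.pos
    omega

instance nonempty_slotEquiv (N K : ℕ) (k : Fin K) : Nonempty (Slot N K k ≃ Fin (N ^ K)) :=
  ⟨Fintype.equivFinOfCardEq (card_slot N K k)⟩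

instance fintype_slotEquiv (N K : ℕ) (k : Fin K) : Fintype (Slot N K k ≃ Fin (N ^ K)) :=
  inferInstance

/-- When message `θ` is wanted, the place of the bit of message `k` that is used in sum `l` of
database `n`.  A bit of message `θ`, or of any message in a sum without message `θ`, is a fresh
one.  The other bits of a sum with message `θ` are side information: they form together a sum
that is downloaded from another database. -/
def sjSlot {N K : ℕ} (θ : Fin K) (n : Fin N) (l : SumLabel N K) (k : Fin K) (hk : k ∈ l.1.1) :
    Slot N K k :=
  if h : θ ∈ l.1.1 ∧ k ≠ θ then
    have hk' : k ∈ l.1.1.erase θ := Finset.mem_erase.2 ⟨h.2, hk⟩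
    ⟨(⟨(n + 1 + l.2 % (N - 1)) % N, Nat.mod_lt _ n.pos⟩,
      ⟨⟨l.1.1.erase θ, ⟨k, hk'⟩⟩, ⟨l.2 / (N - 1), by
        have h1 : (l.1.1.erase θ).card = l.1.1.card - 1 := Finset.card_erase_of_mem h.1
        have h2 : 0 < (l.1.1.erase θ).card := Finset.card_pos.2 ⟨k, hk'⟩
        have h3 := l.2.isLt
        rw [h1] at h2 ⊢
        refine Nat.div_lt_of_lt_mul ?_
        rwa [← pow_succ', Nat.sub_add_cancel h2]⟩⟩), hk'⟩
  else ⟨(n, l), hk⟩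

/-! ### The product design -/

section ProductDesign

variable (N K Ku : ℕ) (m : Fin (Ku + 1) → ℕ)

/-- Memory sharing: each message consists of `m t` independent blocks that are treated by the
product design with parameter `t`, for every `t = 0, …, Ku`. -/
abbrev Block : Type := (t : Fin (Ku + 1)) × Fin (m t)

/-- Packets of a message: a block with parameter `t` and a set of `t` users. -/
abbrev Packet : Type := (b : Block Ku m) × {T : Finset (Fin Ku) // T.card = (b.1 : ℕ)}

/-- Positions of the bits in a message; every packet has `N ^ K` bits. -/
abbrev PDBit : Type := Packet Ku m × Fin (N ^ K)

/-- Coded messages: a block with parameter `t` and a set of `t + 1` users. -/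
abbrev Coded : Type := (b : Block Ku m) × {A : Finset (Fin Ku) // A.card = (b.1 : ℕ) + 1}

/-- The packet that user `u` wants from the coded message for the users in `A`: the one that is
stored by all users in `A` but `u`. -/
def wantedPacket {Ku : ℕ} {m : Fin (Ku + 1) → ℕ} (c : Coded Ku m) (u : {u // u ∈ c.2.1}) :
    Packet Ku m :=
  ⟨c.1, c.2.1.erase u.1, by rw [Finset.card_erase_of_mem u.2, c.2.2, Nat.add_sub_cancel]⟩

/-- User `u` caches, of all messages, the packets that belong to a set of users containing `u`. -/
abbrev CacheCell (u : Fin Ku) : Type := {x : Fin K × PDBit N K Ku m // u ∈ x.2.1.2.1}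

/-- The private randomness of the users: for every coded message, every user served by it and
every message, an enumeration of the bits of the corresponding packet by the places in the
Sun-Jafar scheme. -/
abbrev PDKey : Type :=
  (c : Coded Ku m) → {u // u ∈ c.2.1} → (k : Fin K) → (Slot N K k ≃ Fin (N ^ K))

/-- A query: for every coded message and every user served by it, the bits of the packets that
enter the sums of the Sun-Jafar scheme. -/
abbrev PDQuery : Type :=
  (c : Coded Ku m) → {u // u ∈ c.2.1} → (l : SumLabel N K) → {k // k ∈ l.1.1} → Fin (N ^ K)

/-- The queries for the demand vector `θ`, given the private randomness. -/
def pdQuery (θ : Demand K Ku) (π : PDKey N K Ku m) (n : Fin N) : PDQuery N K Ku m :=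
  fun c u l k => π c u k.1 (sjSlot (θ u.1) n l k.1 k.2)

/-- The product design: Maddah-Ali-Niesen placement; in the coded message for a set of `t + 1`
users, each database returns the sum, over these users, of its Sun-Jafar answers for the packets
they want.  The enumerations of the bits are independent and uniformly distributed. -/
def productDesign : Scheme N K Ku where
  Bit := PDBit N K Ku m
  Cache u := CacheCell N K Ku m u → ZMod 2
  Query := PDQuery N K Ku m
  Answer := Coded Ku m → SumLabel N K → ZMod 2
  cache _ W := fun x => W x.1.1 x.1.2
  query θ _ := (PMF.uniformOfFintype (PDKey N K Ku m)).map (pdQuery N K Ku m θ)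
  answer _ q W := fun c l =>
    ∑ u : {u // u ∈ c.2.1}, ∑ k : {k // k ∈ l.1.1}, W k.1 (wantedPacket c u, q c u l k)

end ProductDesign

end MuPIR

end

open scoped BigOperators

noncomputable section

namespace MuPIR

/-! Converse. Fix one user, with cache `Z`, and let `residual` be the entropy of all answers given
all queries, `Z` and the messages in `T`. Given `Z` the queries are independent of the library, so
decoding a message `k` splits off exactly `H(W_k | Z, W_T)` from the residual and moves `k` into `T`
(`residual_eq`). By privacy the pair (library, query of one database) has the same law for all
demands. Hence one answer, given its own query, conveys equally much whatever the demand, and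
changing the demand costs at most a factor `N` (`residual_le_mul`). Alternating the two steps along
an order `s` of the messages bounds the total answer entropy below by the sum over `j` of `N^(-j)
H(W_{s j} | Z, W_{s 0}, …, W_{s (j-1)})` (`sum_knowledge_le`).

Next, sum over the `K` cyclic orders. By submodularity the summed increments decrease in `j`, as do
the weights `N^(-j)`; their total is at least `K (K - M) L`. Chebyshev's sum inequality then yields
the single-user bound `(1 - M/K) (1 + ⋯ + N^(-(K-1)))` (`le_load`).

Achievability. The corner points for `t = Ku - 1` and `t = Ku` both lie on the line given by this
bound, so sharing memory between these two parameters meets it on the whole range of `M`. The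
product design is private because each database sees every message through a uniformly random
enumeration composed with an injection (`map_pdQuery_eq`). It is decodable because a user knows the
packets meant for the others and because side information in the Sun-Jafar scheme is itself a
downloaded sum (`eq_of_sjAnswer_eq`). -/

/-! ### Entropy on a finite probability space -/

section Entropy

open Classical in
theorem toReal_map_apply {Ω α : Type} [Fintype Ω] (p : PMF Ω) (X : Ω → α) (x : α) :
    ((p.map X) x).toReal = ∑ ω, if X ω = x then (p ω).toReal else 0 := by
  rw [PMF.map_apply, tsum_fintype, ENNReal.toReal_sum]
  · refine Finset.sum_congr rfl fun ω _ => ?_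
    by_cases h : X ω = x
    · simp [h]
    · rw [if_neg h, if_neg (Ne.symm h), ENNReal.toReal_zero]
  · intro ω _
    split_ifs
    · exact p.apply_ne_top ω
    · exact ENNReal.zero_ne_top

theorem sum_toReal_eq_one {α : Type} [Fintype α] (p : PMF α) : ∑ x, (p x).toReal = 1 := by
  rw [← ENNReal.toReal_sum fun x _ => p.apply_ne_top x,
    ← tsum_fintype (L := .unconditional α), p.tsum_coe,
    ENNReal.toReal_one]

theorem sum_toReal_mul_comp {Ω α : Type} [Fintype Ω] [Fintype α] (p : PMF Ω) (X : Ω → α)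
    (f : α → ℝ) :
    ∑ ω, (p ω).toReal * f (X ω) = ∑ x, ((p.map X) x).toReal * f x := by
  classical
  simp_rw [toReal_map_apply, Finset.sum_mul]
  rw [Finset.sum_comm]
  refine Finset.sum_congr rfl fun ω _ => ?_
  rw [Finset.sum_eq_single (X ω)] <;> simp +contextual [eq_comm]

/-- Entropy as an expectation over `Ω`: variables with different alphabets can then be compared
outcome by outcome, in natural logarithms. -/
theorem entropy_mul_log_two {Ω α : Type} [Fintype Ω] [Fintype α] (p : PMF Ω) (X : Ω → α) :
    entropy p X * Real.log 2
      = -∑ ω, (p ω).toReal * Real.log ((p.map X) (X ω)).toReal := by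
  rw [entropy, div_mul_cancel₀ _ (Real.log_pos one_lt_two).ne',
    sum_toReal_mul_comp p X fun x => Real.log ((p.map X) x).toReal, ← Finset.sum_neg_distrib]
  exact Finset.sum_congr rfl fun x _ => by rw [Real.negMulLog, neg_mul]

theorem le_toReal_map_apply {Ω α : Type} [Fintype Ω] (p : PMF Ω) (X : Ω → α) (ω : Ω) :
    (p ω).toReal ≤ ((p.map X) (X ω)).toReal := by
  classical
  rw [toReal_map_apply]
  have := Finset.single_le_sum (f := fun ω' => if X ω' = X ω then (p ω').toReal else 0)
    (fun ω' _ => by positivity) (Finset.mem_univ ω)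
  simpa using this

theorem toReal_pos_of_ne_zero {Ω : Type} (p : PMF Ω) {ω : Ω} (h : p ω ≠ 0) :
    0 < (p ω).toReal :=
  ENNReal.toReal_pos h (p.apply_ne_top ω)

theorem toReal_map_apply_pos {Ω α : Type} [Fintype Ω] (p : PMF Ω) (X : Ω → α) {ω : Ω}
    (h : p ω ≠ 0) : 0 < ((p.map X) (X ω)).toReal :=
  (toReal_pos_of_ne_zero p h).trans_le (le_toReal_map_apply p X ω)

/-- `X` determines `Y` on the support of `p`. -/
def Determines {Ω α β : Type} (p : PMF Ω) (X : Ω → α) (Y : Ω → β) : Prop :=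
  ∀ ω ω', p ω ≠ 0 → p ω' ≠ 0 → X ω = X ω' → Y ω = Y ω'

theorem Determines.toReal_map_le {Ω α β : Type} [Fintype Ω] {p : PMF Ω} {X : Ω → α} {Y : Ω → β}
    (h : Determines p X Y) {ω : Ω} (hω : p ω ≠ 0) :
    ((p.map X) (X ω)).toReal ≤ ((p.map Y) (Y ω)).toReal := by
  classical
  rw [toReal_map_apply, toReal_map_apply]
  refine Finset.sum_le_sum fun ω' _ => ?_
  by_cases h0 : p ω' = 0
  · simp [h0]
  · by_cases h1 : X ω' = X ω
    · rw [if_pos h1, if_pos (h _ _ h0 hω h1)]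
    · rw [if_neg h1]; positivity

theorem Determines.entropy_le {Ω α β : Type} [Fintype Ω] [Fintype α] [Fintype β] {p : PMF Ω}
    {X : Ω → α} {Y : Ω → β} (h : Determines p X Y) : entropy p Y ≤ entropy p X := by
  refine le_of_mul_le_mul_right ?_ (Real.log_pos one_lt_two)
  rw [entropy_mul_log_two, entropy_mul_log_two, neg_le_neg_iff]
  refine Finset.sum_le_sum fun ω _ => ?_
  by_cases h0 : p ω = 0
  · simp [h0]
  · exact mul_le_mul_of_nonneg_left
      (Real.log_le_log (toReal_map_apply_pos p X h0) (h.toReal_map_le h0)) ENNReal.toReal_nonneg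

theorem entropy_eq_of_determines {Ω α β : Type} [Fintype Ω] [Fintype α] [Fintype β] {p : PMF Ω}
    {X : Ω → α} {Y : Ω → β} (h : Determines p X Y) (h' : Determines p Y X) :
    entropy p X = entropy p Y :=
  le_antisymm h'.entropy_le h.entropy_le

theorem entropy_congr {Ω α β : Type} [Fintype Ω] [Fintype α] [Fintype β] (p : PMF Ω)
    {X : Ω → α} {Y : Ω → β} (h : ∀ ω ω', X ω = X ω' ↔ Y ω = Y ω') :
    entropy p X = entropy p Y :=
  entropy_eq_of_determines (fun _ _ _ _ => (h _ _).1) fun _ _ _ _ => (h _ _).2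

theorem entropy_mono {Ω α β : Type} [Fintype Ω] [Fintype α] [Fintype β] (p : PMF Ω)
    {X : Ω → α} {Y : Ω → β} (h : ∀ ω ω', X ω = X ω' → Y ω = Y ω') :
    entropy p Y ≤ entropy p X :=
  Determines.entropy_le fun _ _ _ _ => h _ _

theorem entropy_const {Ω α : Type} [Fintype Ω] [Fintype α] (p : PMF Ω) (a : α) :
    entropy p (fun _ => a) = 0 := by
  have h := entropy_mul_log_two p (fun _ => a)
  have h1 : ((p.map fun _ => a) a).toReal = 1 := by
    rw [toReal_map_apply]; simp [sum_toReal_eq_one]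
  simp only [h1, Real.log_one, mul_zero, Finset.sum_const_zero, neg_zero] at h
  exact (mul_eq_zero.1 h).resolve_right (Real.log_pos one_lt_two).ne'

theorem entropy_map {Ω Ω' α : Type} [Fintype α] (p : PMF Ω) (g : Ω → Ω') (X : Ω' → α) :
    entropy (p.map g) X = entropy p (X ∘ g) := by
  rw [entropy, entropy, PMF.map_comp]

/-- The probability of the value of `(X, Y)` never exceeds that of `Y`, so equal entropies force the
two to agree at every outcome of positive mass. Another such outcome with the same `Y` and a
different `X` would make the second strictly larger. -/
theorem condEntropy_eq_zero_iff {Ω α β : Type} [Fintype Ω] [Fintype α] [Fintype β] (p : PMF Ω)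
    (X : Ω → α) (Y : Ω → β) : condEntropy p X Y = 0 ↔ Determines p Y X := by
  classical
  constructor
  · intro h
    have h0 : entropy p (fun ω => (X ω, Y ω)) * Real.log 2 - entropy p Y * Real.log 2 = 0 := by
      rw [← sub_mul, show entropy p (fun ω => (X ω, Y ω)) - entropy p Y = 0 from h, zero_mul]
    have hd : Determines p (fun ω => (X ω, Y ω)) Y := fun _ _ _ _ h => (Prod.mk.inj h).2
    rw [entropy_mul_log_two, entropy_mul_log_two, neg_sub_neg, ← Finset.sum_sub_distrib,
      Finset.sum_eq_zero_iff_of_nonneg] at h0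
    · intro ω ω' hω hω' hY
      by_contra hX
      have h1 := h0 ω (Finset.mem_univ ω)
      rw [← mul_sub, mul_eq_zero, or_iff_right (toReal_pos_of_ne_zero p hω).ne', sub_eq_zero] at h1
      have h2 := Real.log_injOn_pos (toReal_map_apply_pos p Y hω)
        (toReal_map_apply_pos p (fun ω => (X ω, Y ω)) hω) h1
      rw [toReal_map_apply, toReal_map_apply] at h2
      refine (Finset.sum_lt_sum (fun ω'' _ => ?_) ⟨ω', Finset.mem_univ _, ?_⟩).ne h2.symm
      · by_cases h3 : (X ω'', Y ω'') = (X ω, Y ω)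
        · rw [if_pos h3, if_pos (Prod.mk.inj h3).2]
        · rw [if_neg h3]; positivity
      · rw [if_neg fun h3 => hX (Prod.mk.inj h3).1.symm, if_pos hY.symm]
        exact toReal_pos_of_ne_zero p hω'
    · intro ω _
      by_cases h1 : p ω = 0
      · simp [h1]
      · rw [← mul_sub]
        exact mul_nonneg ENNReal.toReal_nonneg (sub_nonneg.2
          (Real.log_le_log (toReal_map_apply_pos p _ h1) (hd.toReal_map_le h1)))
  · intro h
    refine sub_eq_zero.2 (entropy_eq_of_determines (fun _ _ _ _ h => (Prod.mk.inj h).2) ?_)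
    exact fun ω ω' hω hω' hY => Prod.ext (h ω ω' hω hω' hY) hY

/-- One term of the Gibbs inequality. -/
theorem mul_log_sub_mul_log_le {a b : ℝ} (ha : 0 ≤ a) (hb : 0 ≤ b) (hab : b = 0 → a = 0) :
    a * Real.log b - a * Real.log a ≤ b - a ∧
      (a * Real.log b - a * Real.log a = b - a → a = b) := by
  rcases ha.eq_or_lt with rfl | ha
  · exact ⟨by simpa using hb, fun h => by simpa using h⟩
  · have hb : 0 < b := hb.lt_of_ne fun h => ha.ne' (hab h.symm)
    have h1 : a * Real.log b - a * Real.log a = a * Real.log (b / a) := by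
      rw [Real.log_div hb.ne' ha.ne', mul_sub]
    have h2 : b - a = a * (b / a - 1) := by field_simp
    rw [h1, h2]
    refine ⟨mul_le_mul_of_nonneg_left (Real.log_le_sub_one_of_pos (by positivity)) ha.le, ?_⟩
    intro h
    by_contra hne
    refine (Real.log_lt_sub_one_of_pos (by positivity : 0 < b / a) fun h => ?_).ne
      (mul_left_cancel₀ ha.ne' h)
    rw [div_eq_one_iff_eq ha.ne'] at h
    exact hne h.symm

/-- Gibbs' inequality. No normalization is needed, only that `b` has no more mass than `a`. -/
theorem sum_mul_log_le {ι : Type} [Fintype ι] {a b : ι → ℝ} (ha : ∀ i, 0 ≤ a i)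
    (hb : ∀ i, 0 ≤ b i) (hab : ∀ i, b i = 0 → a i = 0) (hs : ∑ i, b i ≤ ∑ i, a i) :
    ∑ i, a i * Real.log (b i) ≤ ∑ i, a i * Real.log (a i) := by
  have h := Finset.sum_le_sum fun i (_ : i ∈ Finset.univ) =>
    (mul_log_sub_mul_log_le (ha i) (hb i) (hab i)).1
  simp only [Finset.sum_sub_distrib] at h
  linarith

theorem eq_of_sum_mul_log_eq {ι : Type} [Fintype ι] {a b : ι → ℝ} (ha : ∀ i, 0 ≤ a i)
    (hb : ∀ i, 0 ≤ b i) (hab : ∀ i, b i = 0 → a i = 0) (hs : ∑ i, b i ≤ ∑ i, a i)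
    (h : ∑ i, a i * Real.log (b i) = ∑ i, a i * Real.log (a i)) (i : ι) : a i = b i := by
  have h1 := fun i (_ : i ∈ Finset.univ) => (mul_log_sub_mul_log_le (ha i) (hb i) (hab i)).1
  have h2 := Finset.sum_le_sum h1
  refine (mul_log_sub_mul_log_le (ha i) (hb i) (hab i)).2
    ((Finset.sum_eq_sum_iff_of_le h1).1 (le_antisymm h2 ?_) i (Finset.mem_univ i))
  simp only [Finset.sum_sub_distrib]
  linarith

theorem sum_map_prod_left {Ω α β : Type} [Fintype Ω] [Fintype α] (p : PMF Ω) (X : Ω → α)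
    (Y : Ω → β) (y : β) :
    ∑ x, ((p.map fun ω => (X ω, Y ω)) (x, y)).toReal = ((p.map Y) y).toReal := by
  classical
  simp_rw [toReal_map_apply]
  rw [Finset.sum_comm]
  refine Finset.sum_congr rfl fun ω _ => ?_
  rw [Finset.sum_eq_single (X ω)] <;> simp +contextual [eq_comm]

/-- Puts the entropies of all marginals of `J` over the one alphabet of `J`, as the Gibbs inequality
requires. -/
theorem entropy_eq_log_two_comp {Ω α β : Type} [Fintype Ω] [Fintype α] [Fintype β] (p : PMF Ω)
    (J : Ω → α) (f : α → β) :
    entropy p (fun ω => f (J ω)) * Real.log 2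
      = -∑ j, ((p.map J) j).toReal * Real.log ((p.map fun ω => f (J ω)) (f j)).toReal := by
  rw [entropy_mul_log_two,
    ← sum_toReal_mul_comp p J fun j => Real.log ((p.map fun ω => f (J ω)) (f j)).toReal]

theorem toReal_map_comp_eq_zero {Ω α β : Type} [Fintype Ω] (p : PMF Ω)
    (J : Ω → α) (f : α → β) {j : α} (h : ((p.map fun ω => f (J ω)) (f j)).toReal = 0) :
    ((p.map J) j).toReal = 0 := by
  classical
  rw [toReal_map_apply, Finset.sum_eq_zero_iff_of_nonneg fun ω _ => by positivity] at h ⊢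
  intro ω hω
  have := h ω hω
  by_cases h1 : J ω = j
  · rw [if_pos (by rw [h1])] at this
    rw [if_pos h1, this]
  · rw [if_neg h1]

theorem mul_log_mul_div {a b c d : ℝ} (hb : b = 0 → a = 0) (hc : c = 0 → a = 0)
    (hd : d = 0 → a = 0) :
    a * Real.log (b * c / d) = a * Real.log b + a * Real.log c - a * Real.log d := by
  by_cases ha : a = 0
  · simp [ha]
  · rw [Real.log_div (mul_ne_zero (fun h => ha (hb h)) fun h => ha (hc h)) fun h => ha (hd h),
      Real.log_mul (fun h => ha (hb h)) fun h => ha (hc h)]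
    ring

/-- Submodularity of the entropy. -/
theorem entropy_add_entropy_le {Ω α β γ : Type} [Fintype Ω] [Fintype α] [Fintype β] [Fintype γ]
    (p : PMF Ω) (X : Ω → α) (Y : Ω → β) (Z : Ω → γ) :
    entropy p (fun ω => (X ω, Y ω, Z ω)) + entropy p Z
      ≤ entropy p (fun ω => (X ω, Z ω)) + entropy p (fun ω => (Y ω, Z ω)) := by
  refine le_of_mul_le_mul_right ?_ (Real.log_pos one_lt_two)
  set J : Ω → α × β × γ := fun ω => (X ω, Y ω, Z ω) with hJ
  set a : α × β × γ → ℝ := fun j => ((p.map J) j).toReal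
  set xz : α × γ → ℝ := fun j => ((p.map fun ω => (X ω, Z ω)) j).toReal with hxz
  set yz : β × γ → ℝ := fun j => ((p.map fun ω => (Y ω, Z ω)) j).toReal with hyz
  set z : γ → ℝ := fun j => ((p.map Z) j).toReal with hz
  have e1 := entropy_eq_log_two_comp p J (fun j => j)
  have e2 := entropy_eq_log_two_comp p J (fun j => (j.1, j.2.2))
  have e3 := entropy_eq_log_two_comp p J (fun j => j.2)
  have e4 := entropy_eq_log_two_comp p J (fun j => j.2.2)
  have n2 : ∀ j, xz (j.1, j.2.2) = 0 → a j = 0 := fun j =>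
    toReal_map_comp_eq_zero p J (fun j => (j.1, j.2.2))
  have n3 : ∀ j, yz j.2 = 0 → a j = 0 := fun j => toReal_map_comp_eq_zero p J (fun j => j.2)
  have n4 : ∀ j, z j.2.2 = 0 → a j = 0 := fun j => toReal_map_comp_eq_zero p J (fun j => j.2.2)
  -- Gibbs against the law that makes `X` and `Y` conditionally independent given `Z`.
  have key : ∑ j, a j * Real.log (xz (j.1, j.2.2) * yz j.2 / z j.2.2)
      ≤ ∑ j, a j * Real.log (a j) := by
    refine sum_mul_log_le (fun j => ENNReal.toReal_nonneg) (fun j => ?_) (fun j h => ?_) ?_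
    · simp only [hxz, hyz, hz]; positivity
    · rcases div_eq_zero_iff.1 h with h | h
      · rcases mul_eq_zero.1 h with h | h
        · exact n2 j h
        · exact n3 j h
      · exact n4 j h
    · have hs : ∑ j, a j = 1 := sum_toReal_eq_one _
      rw [hs, ← sum_toReal_eq_one (p.map Z), Fintype.sum_prod_type]
      simp_rw [Fintype.sum_prod_type]
      rw [Finset.sum_comm]
      simp_rw [Finset.sum_comm (s := (Finset.univ : Finset α)) (t := (Finset.univ : Finset γ))]
      rw [Finset.sum_comm]
      refine Finset.sum_le_sum fun c _ => le_of_eq ?_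
      simp_rw [← Finset.sum_div, ← Finset.sum_mul, ← Finset.mul_sum]
      rw [show ∑ x, xz (x, c) = z c from sum_map_prod_left p X Z c,
        show ∑ y, yz (y, c) = z c from sum_map_prod_left p Y Z c]
      -- This includes the values of `Z` of probability zero, where `0 * 0 / 0 = 0`.
      exact mul_self_div_self _
  simp_rw [fun j => mul_log_mul_div (n2 j) (n3 j) (n4 j), Finset.sum_sub_distrib,
    Finset.sum_add_distrib] at key
  rw [add_mul, add_mul]
  linarith

theorem entropy_prod_le {Ω α β : Type} [Fintype Ω] [Fintype α] [Fintype β]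
    (p : PMF Ω) (X : Ω → α) (Y : Ω → β) :
    entropy p (fun ω => (X ω, Y ω)) ≤ entropy p X + entropy p Y := by
  have h := entropy_add_entropy_le p X Y fun _ => ()
  have h1 := entropy_const p ()
  have h2 : entropy p (fun ω => (X ω, Y ω, ())) = entropy p (fun ω => (X ω, Y ω)) :=
    entropy_congr p fun _ _ => by simp
  have h3 : entropy p (fun ω => (X ω, ())) = entropy p X := entropy_congr p fun _ _ => by simp
  have h4 : entropy p (fun ω => (Y ω, ())) = entropy p Y := entropy_congr p fun _ _ => by simp
  linarith

theorem entropy_le_logb_card {Ω α : Type} [Fintype Ω] [Fintype α] (p : PMF Ω) (X : Ω → α) :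
    entropy p X ≤ Real.logb 2 (Fintype.card α) := by
  rw [Real.logb, le_div_iff₀ (Real.log_pos one_lt_two)]
  have : Nonempty α := ⟨X p.support_nonempty.some⟩
  have hc : (0 : ℝ) < Fintype.card α := by exact_mod_cast Fintype.card_pos
  have h1 := entropy_eq_log_two_comp p X fun x => x
  have h2 : ∑ x, ((p.map X) x).toReal * Real.log ((Fintype.card α : ℝ)⁻¹)
      ≤ ∑ x, ((p.map X) x).toReal * Real.log ((p.map X) x).toReal := by
    refine sum_mul_log_le (b := fun _ => (Fintype.card α : ℝ)⁻¹) (fun j => ENNReal.toReal_nonneg)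
      (fun j => by positivity) (fun j h => absurd h (by positivity)) ?_
    rw [sum_toReal_eq_one]
    simp [hc.ne']
  rw [← Finset.sum_mul, sum_toReal_eq_one, one_mul, Real.log_inv] at h2
  linarith

theorem entropy_uniformOfFintype {Ω : Type} [Fintype Ω] [Nonempty Ω] :
    entropy (PMF.uniformOfFintype Ω) (fun ω => ω) = Real.logb 2 (Fintype.card Ω) := by
  rw [Real.logb, eq_div_iff (Real.log_pos one_lt_two).ne', entropy_mul_log_two]
  simp [show (fun ω : Ω => ω) = id from rfl, PMF.map_id]

/-- Mutual information is the divergence of the joint law from the product of the marginals, and the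
equality case of Gibbs' inequality applies. -/
theorem mutualInfo_eq_zero_iff {Ω α β : Type} [Fintype Ω] [Fintype α] [Fintype β] (p : PMF Ω)
    (X : Ω → α) (Y : Ω → β) :
    mutualInfo p X Y = 0 ↔ ∀ x y, ((p.map fun ω => (X ω, Y ω)) (x, y)).toReal
      = ((p.map X) x).toReal * ((p.map Y) y).toReal := by
  set J : Ω → α × β := fun ω => (X ω, Y ω) with hJ
  have e1 := entropy_eq_log_two_comp p J (fun j => j)
  have e2 := entropy_eq_log_two_comp p J (fun j => j.1)
  have e3 := entropy_eq_log_two_comp p J (fun j => j.2)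
  have n2 : ∀ j : α × β, ((p.map X) j.1).toReal = 0 → ((p.map J) j).toReal = 0 := fun j =>
    toReal_map_comp_eq_zero p J (fun j => j.1)
  have n3 : ∀ j : α × β, ((p.map Y) j.2).toReal = 0 → ((p.map J) j).toReal = 0 := fun j =>
    toReal_map_comp_eq_zero p J (fun j => j.2)
  have hlog : ∑ j : α × β, ((p.map J) j).toReal
      * Real.log (((p.map X) j.1).toReal * ((p.map Y) j.2).toReal)
      = ∑ j : α × β, ((p.map J) j).toReal * Real.log ((p.map X) j.1).toReal
        + ∑ j : α × β, ((p.map J) j).toReal * Real.log ((p.map Y) j.2).toReal := by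
    rw [← Finset.sum_add_distrib]
    refine Finset.sum_congr rfl fun j _ => ?_
    have := mul_log_mul_div (d := 1) (n2 j) (n3 j) (fun h => absurd h one_ne_zero)
    simpa using this
  have hI : mutualInfo p X Y * Real.log 2 = ∑ j, ((p.map J) j).toReal * Real.log ((p.map J) j).toReal
      - ∑ j : α × β, ((p.map J) j).toReal
        * Real.log (((p.map X) j.1).toReal * ((p.map Y) j.2).toReal) := by
    rw [mutualInfo, sub_mul, add_mul, hlog]
    linarith
  constructor
  · intro h x y
    rw [h, zero_mul] at hI
    refine eq_of_sum_mul_log_eq (a := fun j : α × β => ((p.map J) j).toReal)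
      (b := fun j : α × β => ((p.map X) j.1).toReal * ((p.map Y) j.2).toReal)
      (fun j => ENNReal.toReal_nonneg) (fun j => by positivity) (fun j h => ?_) ?_
      (by linarith) (x, y)
    · rcases mul_eq_zero.1 h with h | h
      · exact n2 j h
      · exact n3 j h
    · rw [sum_toReal_eq_one, Fintype.sum_prod_type]
      simp_rw [← Finset.mul_sum, sum_toReal_eq_one, mul_one]
      rw [sum_toReal_eq_one]
  · intro h
    have h2 : mutualInfo p X Y * Real.log 2 = 0 := by
      rw [hI, sub_eq_zero]
      exact Finset.sum_congr rfl fun j _ => by rw [← h j.1 j.2]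
    exact (mul_eq_zero.1 h2).resolve_right (Real.log_pos one_lt_two).ne'

end Entropy

/-! ### Joint laws given by a kernel -/

section Compound

/-- The joint law of a first coordinate with law `ν` and a second one generated from it by `κ`. -/
def compound {α β : Type} (ν : PMF α) (κ : α → PMF β) : PMF (α × β) :=
  ν.bind fun a => (κ a).map (Prod.mk a)

theorem compound_apply {α β : Type} (ν : PMF α) (κ : α → PMF β) (a : α) (b : β) :
    compound ν κ (a, b) = ν a * κ a b := by
  classical
  rw [compound, PMF.bind_apply, tsum_eq_single a]
  · congr 1
    rw [PMF.map_apply, tsum_eq_single b]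
    · simp
    · intro b' hb'
      rw [if_neg fun h => hb' (Prod.mk.inj h).2.symm]
  · intro a' ha'
    rw [PMF.map_apply, ENNReal.tsum_eq_zero.2, mul_zero]
    intro b'
    rw [if_neg fun h => ha' (Prod.mk.inj h).1.symm]

theorem compound_ne_zero_iff {α β : Type} (ν : PMF α) (κ : α → PMF β) (a : α) (b : β) :
    compound ν κ (a, b) ≠ 0 ↔ ν a ≠ 0 ∧ κ a b ≠ 0 := by
  rw [compound_apply, mul_ne_zero_iff]

theorem compound_map_fst {α β : Type} (ν : PMF α) (κ : α → PMF β) :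
    (compound ν κ).map Prod.fst = ν := by
  simp only [compound, PMF.map_bind, PMF.map_comp]
  have : ∀ a, (κ a).map (Prod.fst ∘ Prod.mk a) = PMF.pure a := fun a => PMF.map_const (κ a) a
  simp_rw [this, PMF.bind_pure]

theorem compound_map_snd {α β γ : Type} (ν : PMF α) (κ : α → PMF β) (g : β → γ) :
    (compound ν κ).map (fun x => g x.2) = ν.bind fun a => (κ a).map g := by
  simp only [compound, PMF.map_bind, PMF.map_comp]
  rfl

theorem compound_map_prod {α β γ : Type} (ν : PMF α) (κ : α → PMF β) (g : β → γ) :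
    (compound ν κ).map (fun x => (x.1, g x.2)) = compound ν fun a => (κ a).map g := by
  simp only [compound, PMF.map_bind, PMF.map_comp]
  rfl

theorem mutualInfo_compound_eq_zero_iff {α β γ : Type} [Fintype α] [Fintype β] [Fintype γ]
    (ν : PMF α) (hν : ∀ a, ν a ≠ 0) (κ : α → PMF β) (g : β → γ) :
    mutualInfo (compound ν κ) (fun x => x.1) (fun x => g x.2) = 0
      ↔ ∀ a a', (κ a).map g = (κ a').map g := by
  rw [mutualInfo_eq_zero_iff]
  have h1 := compound_map_fst ν κ
  simp only [compound_map_prod, compound_apply, compound_map_snd, ENNReal.toReal_mul,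
    show (compound ν κ).map (fun x => x.1) = ν from h1]
  constructor
  · intro h
    have key : ∀ a, (κ a).map g = ν.bind fun a => (κ a).map g := fun a => by
      ext y
      have := mul_left_cancel₀ (toReal_pos_of_ne_zero ν (hν a)).ne' (h a y)
      exact (ENNReal.toReal_eq_toReal_iff' (PMF.apply_ne_top _ _) (PMF.apply_ne_top _ _)).1 this
    intro a a'
    rw [key a, key a']
  · intro h a y
    rw [show (fun a => (κ a).map g) = fun _ => (κ a).map g from funext fun a' => h a' a,
      PMF.bind_const]

theorem determines_compound_iff {α β γ δ : Type} (ν : PMF α) (hν : ∀ a, ν a ≠ 0)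
    (κ : α → PMF β) (g : α → β → γ) (f : α → β → δ) :
    Determines (compound ν κ) (fun x => (x.1, g x.1 x.2)) (fun x => f x.1 x.2)
      ↔ ∀ a, Determines (κ a) (g a) (f a) := by
  constructor
  · intro h a b b' hb hb' hg
    exact h (a, b) (a, b') ((compound_ne_zero_iff _ _ _ _).2 ⟨hν a, hb⟩)
      ((compound_ne_zero_iff _ _ _ _).2 ⟨hν a, hb'⟩) (Prod.ext rfl hg)
  · rintro h ⟨a, b⟩ ⟨a', b'⟩ hb hb' hg
    obtain ⟨rfl, hg⟩ := Prod.mk.inj hg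
    exact h _ b b' ((compound_ne_zero_iff _ _ _ _).1 hb).2 ((compound_ne_zero_iff _ _ _ _).1 hb').2 hg

section Markov

variable {Λ Q γ ρ α : Type} [Fintype Λ] [Fintype Q]
  (ν : PMF Λ) (κ : Λ → PMF Q) (Z : Λ → γ) (hκ : ∀ w w', Z w = Z w' → κ w = κ w')

-- On the event that `Z` and `F` take given values the kernel is constant, so the probability
-- factors into a query part and a library part.
include hκ in
open Classical in
theorem toReal_compound_map_apply (r : Q → ρ) (F : ρ → Λ → α) (w : Λ) (q : Q) :
    (((compound ν κ).map fun x => (r x.2, Z x.1, F (r x.2) x.1)) (r q, Z w, F (r q) w)).toReal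
      = (((κ w).map r) (r q)).toReal
        * ∑ w', if Z w' = Z w ∧ F (r q) w' = F (r q) w then (ν w').toReal else 0 := by
  rw [toReal_map_apply, toReal_map_apply, Fintype.sum_prod_type, Finset.mul_sum]
  refine Finset.sum_congr rfl fun w' _ => ?_
  simp only [compound_apply, ENNReal.toReal_mul, Prod.mk.injEq]
  by_cases h : Z w' = Z w ∧ F (r q) w' = F (r q) w
  · rw [if_pos h, Finset.sum_mul]
    refine Finset.sum_congr rfl fun q' _ => ?_
    by_cases hr : r q' = r q
    · rw [if_pos ⟨hr, h.1, hr ▸ h.2⟩, if_pos hr, hκ _ _ h.1, mul_comm]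
    · rw [if_neg fun h => hr h.1, if_neg hr, zero_mul]
  · rw [if_neg h, mul_zero]
    refine Finset.sum_eq_zero fun q' _ => if_neg fun h' => h ⟨h'.2.1,
      (congrArg (fun t => F t w') h'.1).symm.trans h'.2.2⟩

-- The library part is the same in both probabilities and cancels in the difference of logarithms;
-- `F` is absent from the right-hand side.
include hκ in
theorem entropy_compound_sub_mul_log_two [Fintype γ] [Fintype ρ] [Fintype α]
    (r : Q → ρ) (F : ρ → Λ → α) :
    (entropy (compound ν κ) (fun x => (x.2, Z x.1, F (r x.2) x.1))
      - entropy (compound ν κ) (fun x => (r x.2, Z x.1, F (r x.2) x.1))) * Real.log 2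
      = ∑ x : Λ × Q, (compound ν κ x).toReal * (Real.log (((κ x.1).map r) (r x.2)).toReal
        - Real.log ((κ x.1) x.2).toReal) := by
  classical
  rw [sub_mul, entropy_mul_log_two, entropy_mul_log_two, neg_sub_neg, ← Finset.sum_sub_distrib]
  refine Finset.sum_congr rfl fun x _ => ?_
  obtain ⟨w, q⟩ := x
  by_cases h0 : compound ν κ (w, q) = 0
  · simp [h0]
  have h1 := (compound_ne_zero_iff ν κ w q).1 h0
  rw [← mul_sub]
  congr 1
  have e1 := toReal_compound_map_apply ν κ Z hκ r F w q
  have e2 := toReal_compound_map_apply ν κ Z hκ (fun q => q) (fun q => F (r q)) w q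
  have hm : (0 : ℝ) < ∑ w', if Z w' = Z w ∧ F (r q) w' = F (r q) w then (ν w').toReal else 0 := by
    refine Finset.sum_pos' (fun _ _ => by positivity) ⟨w, Finset.mem_univ w, ?_⟩
    rw [if_pos ⟨rfl, rfl⟩]
    exact toReal_pos_of_ne_zero ν h1.1
  simp only at e1 e2 ⊢
  rw [e1, e2, Real.log_mul (toReal_map_apply_pos (κ w) r h1.2).ne' hm.ne',
    Real.log_mul (toReal_map_apply_pos (κ w) (fun q => q) h1.2).ne' hm.ne',
    show (κ w).map (fun q => q) = κ w from PMF.map_id _]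
  ring

include hκ in
/-- If the second coordinate is generated from `Z`, then what a function of it leaves open about it
does not depend on what else is known about the first coordinate. -/
theorem entropy_compound_sub_eq {α' : Type} [Fintype γ] [Fintype ρ] [Fintype α] [Fintype α']
    (r : Q → ρ) (F : ρ → Λ → α) (F' : ρ → Λ → α') :
    entropy (compound ν κ) (fun x => (x.2, Z x.1, F (r x.2) x.1))
      - entropy (compound ν κ) (fun x => (r x.2, Z x.1, F (r x.2) x.1))
    = entropy (compound ν κ) (fun x => (x.2, Z x.1, F' (r x.2) x.1))
      - entropy (compound ν κ) (fun x => (r x.2, Z x.1, F' (r x.2) x.1)) :=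
  mul_right_cancel₀ (Real.log_pos one_lt_two).ne'
    ((entropy_compound_sub_mul_log_two ν κ Z hκ r F).trans
      (entropy_compound_sub_mul_log_two ν κ Z hκ r F').symm)

end Markov

end Compound

/-! ### The law of a scheme for a fixed demand vector -/

namespace Scheme

variable {N K Ku : ℕ} (S : Scheme N K Ku)

/-- The joint law of the library and the queries for the demand vector `θ`. -/
def lawGiven (θ : Demand K Ku) : PMF (Library K S.Bit × (Fin N → S.Query)) :=
  compound (PMF.uniformOfFintype (Library K S.Bit)) fun W => S.query θ (S.caches W)

theorem law_eq_compound (P : PMF (Demand K Ku)) : S.law P = compound P S.lawGiven := by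
  simp only [law, compound, lawGiven, PMF.map_bind, PMF.map_comp]
  rfl

/-- Full support turns independence of the demands into equality of the conditional laws. The answer
and the caches are functions of the library and the query, so they can be dropped. -/
theorem private_iff {P : PMF (Demand K Ku)} (hP : ∀ θ, P θ ≠ 0) :
    S.Private P ↔ ∀ (n : Fin N) (θ θ' : Demand K Ku),
      (S.lawGiven θ).map (fun x => (x.1, x.2 n)) = (S.lawGiven θ').map (fun x => (x.1, x.2 n)) := by
  refine forall_congr' fun n => ?_
  rw [law_eq_compound]
  refine (mutualInfo_compound_eq_zero_iff P hP S.lawGiven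
    (fun x => (x.2 n, S.answer n (x.2 n) x.1, x.1, S.caches x.1))).trans
    (forall_congr' fun θ => forall_congr' fun θ' => ⟨fun h => ?_, fun h => ?_⟩)
  · have := congrArg (PMF.map fun y => (y.2.2.1, y.1)) h
    simpa only [PMF.map_comp, Function.comp_def] using this
  · have := congrArg (PMF.map fun y => (y.2, S.answer n y.2 y.1, y.1, S.caches y.1)) h
    simpa only [PMF.map_comp, Function.comp_def] using this

theorem decodable_iff {P : PMF (Demand K Ku)} (hP : ∀ θ, P θ ≠ 0) :
    S.Decodable P ↔ ∀ (u : Fin Ku) (θ : Demand K Ku), Determines (S.lawGiven θ)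
      (fun x => (x.2, fun n => S.answer n (x.2 n) x.1, S.cache u x.1)) (fun x => x.1 (θ u)) := by
  refine forall_congr' fun u => ?_
  rw [condEntropy_eq_zero_iff, law_eq_compound]
  exact determines_compound_iff P hP S.lawGiven
    (fun _ x => (x.2, fun n => S.answer n (x.2 n) x.1, S.cache u x.1)) (fun θ x => x.1 (θ u))

/-- An answer has the same law for all demands, hence also after averaging over `P`. The converse
may thus fix convenient demand vectors. -/
theorem entropy_ans_eq {P : PMF (Demand K Ku)} (hP : ∀ θ, P θ ≠ 0) (h : S.Private P) (n : Fin N)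
    (θ : Demand K Ku) : entropy (S.law P) (S.ans n)
      = entropy (S.lawGiven θ) (fun x => S.answer n (x.2 n) x.1) := by
  have h1 : ∀ θ', (S.lawGiven θ').map (fun x => S.answer n (x.2 n) x.1)
      = (S.lawGiven θ).map (fun x => S.answer n (x.2 n) x.1) := fun θ' => by
    have := congrArg (PMF.map fun y => S.answer n y.2 y.1) ((S.private_iff hP).1 h n θ' θ)
    simpa only [PMF.map_comp, Function.comp_def] using this
  have h2 : (S.law P).map (S.ans n) = (S.lawGiven θ).map (fun x => S.answer n (x.2 n) x.1) := by
    rw [law_eq_compound]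
    refine (compound_map_snd P S.lawGiven fun x => S.answer n (x.2 n) x.1).trans ?_
    simp_rw [h1, PMF.bind_const]
  rw [entropy, entropy, h2]

end Scheme

/-! ### The converse -/

/-- The messages with labels in `T`. -/
def restrict {K : ℕ} {Bit : Type} (T : Finset (Fin K)) (W : Library K Bit) : Library K Bit :=
  fun k => if k ∈ T then W k else 0

theorem restrict_eq_iff {K : ℕ} {Bit : Type} (T : Finset (Fin K)) (W W' : Library K Bit) :
    restrict T W = restrict T W' ↔ ∀ k ∈ T, W k = W' k := by
  rw [funext_iff]
  refine forall_congr' fun k => ?_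
  by_cases h : k ∈ T <;> simp [restrict, h]

theorem restrict_insert_eq_iff {K : ℕ} {Bit : Type} (k : Fin K) (T : Finset (Fin K))
    (W W' : Library K Bit) : restrict (insert k T) W = restrict (insert k T) W'
      ↔ W k = W' k ∧ restrict T W = restrict T W' := by
  simp only [restrict_eq_iff, Finset.mem_insert, forall_eq_or_imp]

/-- Conditioned on `Z`, a finite family has at most the sum of the entropies of its members. -/
theorem entropy_pi_sub_le {Ω γ α : Type} [Fintype Ω] [Fintype γ] [Fintype α] {n : ℕ} (p : PMF Ω)
    (X : Fin n → Ω → α) (Z : Ω → γ) :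
    entropy p (fun ω => (fun i => X i ω, Z ω)) - entropy p Z
      ≤ ∑ i, (entropy p (fun ω => (X i ω, Z ω)) - entropy p Z) := by
  induction n with
  | zero =>
    rw [Fin.sum_univ_zero, entropy_congr p (Y := Z) fun ω ω' => by simp [funext_iff], sub_self]
  | succ n ih =>
    rw [Fin.sum_univ_succ]
    have h1 := ih fun i => X i.succ
    have h2 := entropy_add_entropy_le p (X 0) (fun ω i => X (Fin.succ i) ω) Z
    rw [entropy_congr p (X := fun ω => (fun i => X i ω, Z ω))
      (Y := fun ω => (X 0 ω, (fun i => X (Fin.succ i) ω), Z ω))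
      fun ω ω' => by simp [funext_iff, Fin.forall_fin_succ, and_assoc]]
    linarith

namespace Scheme

variable {N K Ku : ℕ} (S : Scheme N K Ku)

/-- What the answers convey for the demand vector `θ`, beyond the queries, the cache of user `u`
and the messages in `T`. -/
def residual (u : Fin Ku) (θ : Demand K Ku) (T : Finset (Fin K)) : ℝ :=
  entropy (S.lawGiven θ)
      (fun x => (fun n => S.answer n (x.2 n) x.1, x.2, S.cache u x.1, restrict T x.1))
    - entropy (S.lawGiven θ) (fun x => (x.2, S.cache u x.1, restrict T x.1))

/-- The joint entropy of the cache of user `u` and the messages in `T`. -/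
def knowledge (u : Fin Ku) (T : Finset (Fin K)) : ℝ :=
  entropy (PMF.uniformOfFintype (Library K S.Bit)) (fun W => (S.cache u W, restrict T W))

theorem residual_nonneg (u : Fin Ku) (θ : Demand K Ku) (T : Finset (Fin K)) :
    0 ≤ S.residual u θ T :=
  sub_nonneg.2 (entropy_mono _ fun _ _ h => (Prod.mk.inj h).2)

theorem entropy_lawGiven_fst {α : Type} [Fintype α] (θ : Demand K Ku)
    (f : Library K S.Bit → α) :
    entropy (S.lawGiven θ) (fun x => f x.1)
      = entropy (PMF.uniformOfFintype (Library K S.Bit)) f := by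
  have h := entropy_map (S.lawGiven θ) Prod.fst f
  rw [lawGiven, compound_map_fst] at h
  exact h.symm

/-- Each side is the entropy of the queries given the cache and some messages; beyond the cache,
messages say nothing about the queries. -/
theorem entropy_queries_sub (hS : S.QueriesConsistent) (u : Fin Ku) (θ : Demand K Ku)
    (T T' : Finset (Fin K)) :
    entropy (S.lawGiven θ) (fun x => (x.2, S.cache u x.1, restrict T x.1)) - S.knowledge u T
      = entropy (S.lawGiven θ) (fun x => (x.2, S.cache u x.1, restrict T' x.1))
        - S.knowledge u T' := by
  have h := entropy_compound_sub_eq (PMF.uniformOfFintype (Library K S.Bit))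
    (fun W => S.query θ (S.caches W)) (S.cache u) (hS θ u) (fun _ => ())
    (fun _ W => restrict T W) (fun _ W => restrict T' W)
  have h1 : ∀ T, S.knowledge u T
      = entropy (S.lawGiven θ) (fun x => ((), S.cache u x.1, restrict T x.1)) := fun T => by
    rw [knowledge, ← S.entropy_lawGiven_fst θ]
    exact entropy_congr _ fun _ _ => by simp
  rw [h1, h1]
  exact h

/-- Decoding: the answers convey the demanded message. -/
theorem residual_eq {P : PMF (Demand K Ku)} (hP : ∀ θ, P θ ≠ 0) (hS : S.Valid P) (u : Fin Ku)
    (θ : Demand K Ku) (T : Finset (Fin K)) :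
    S.residual u θ T = S.residual u θ (insert (θ u) T)
      + (S.knowledge u (insert (θ u) T) - S.knowledge u T) := by
  have h1 := S.entropy_queries_sub hS.queries u θ T (insert (θ u) T)
  have h2 : entropy (S.lawGiven θ)
        (fun x => (fun n => S.answer n (x.2 n) x.1, x.2, S.cache u x.1, restrict T x.1))
      = entropy (S.lawGiven θ) (fun x => (fun n => S.answer n (x.2 n) x.1, x.2, S.cache u x.1,
        restrict (insert (θ u) T) x.1)) := by
    have hd := (S.decodable_iff hP).1 hS.decodable u θ
    refine entropy_eq_of_determines (fun x x' hx hx' h => ?_) (fun x x' hx hx' h => ?_)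
    · simp only [Prod.mk.injEq, restrict_insert_eq_iff] at h ⊢
      exact ⟨h.1, h.2.1, h.2.2.1, hd x x' hx hx' (by simp only [Prod.mk.injEq]; tauto), h.2.2.2⟩
    · simp only [Prod.mk.injEq, restrict_insert_eq_iff] at h ⊢
      tauto
  rw [residual, residual, h2]
  linarith

/-- Privacy: the answer of one database conveys the same for all demand vectors. -/
theorem residual_le_mul {P : PMF (Demand K Ku)} (hP : ∀ θ, P θ ≠ 0) (hS : S.Valid P) (u : Fin Ku)
    (θ θ' : Demand K Ku) (T : Finset (Fin K)) :
    S.residual u θ' T ≤ N * S.residual u θ T := by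
  have h1 : ∀ n, entropy (S.lawGiven θ')
        (fun x => (S.answer n (x.2 n) x.1, x.2, S.cache u x.1, restrict T x.1))
      - entropy (S.lawGiven θ') (fun x => (x.2, S.cache u x.1, restrict T x.1))
      ≤ S.residual u θ T := by
    intro n
    have key : ∀ θ, entropy (S.lawGiven θ)
        (fun x => (S.answer n (x.2 n) x.1, x.2, S.cache u x.1, restrict T x.1))
      - entropy (S.lawGiven θ) (fun x => (x.2, S.cache u x.1, restrict T x.1))
      = entropy (S.lawGiven θ)
        (fun x => (x.2 n, S.cache u x.1, S.answer n (x.2 n) x.1, restrict T x.1))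
      - entropy (S.lawGiven θ) (fun x => (x.2 n, S.cache u x.1, restrict T x.1)) := by
      intro θ
      -- Given its own query, the cache and `W_T`, the answer of database `n` is independent of the
      -- remaining queries; these may be dropped from the conditioning.
      have h := entropy_compound_sub_eq (PMF.uniformOfFintype (Library K S.Bit))
        (fun W => S.query θ (S.caches W)) (S.cache u) (hS.queries θ u) (fun q => q n)
        (fun r W => (S.answer n r W, restrict T W)) (fun _ W => restrict T W)
      have h2 : entropy (S.lawGiven θ)
          (fun x => (S.answer n (x.2 n) x.1, x.2, S.cache u x.1, restrict T x.1))
          = entropy (S.lawGiven θ)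
          (fun x => (x.2, S.cache u x.1, S.answer n (x.2 n) x.1, restrict T x.1)) :=
        entropy_congr _ fun _ _ => by simp only [Prod.mk.injEq]; tauto
      rw [h2]
      simp only [lawGiven]
      linarith
    have hpriv := (S.private_iff hP).1 hS.isPrivate n θ' θ
    have e : ∀ {α : Type} [Fintype α] (f : Library K S.Bit × S.Query → α),
        entropy (S.lawGiven θ') (fun x => f (x.1, x.2 n))
          = entropy (S.lawGiven θ) (fun x => f (x.1, x.2 n)) := by
      intro α _ f
      have h := entropy_map (S.lawGiven θ') (fun x => (x.1, x.2 n)) f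
      rw [hpriv, entropy_map] at h
      exact h.symm
    rw [key θ', e fun y => (y.2, S.cache u y.1, S.answer n y.2 y.1, restrict T y.1),
      e fun y => (y.2, S.cache u y.1, restrict T y.1), ← key θ, residual]
    refine sub_le_sub_right (entropy_mono _ fun x x' h => ?_) _
    simp only [Prod.mk.injEq] at h ⊢
    exact ⟨congrFun h.1 n, h.2⟩
  refine (entropy_pi_sub_le (S.lawGiven θ') (fun n x => S.answer n (x.2 n) x.1)
    (fun x => (x.2, S.cache u x.1, restrict T x.1))).trans
    ((Finset.sum_le_sum fun n _ => h1 n).trans ?_)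
  simp

theorem residual_empty_le {P : PMF (Demand K Ku)} (hP : ∀ θ, P θ ≠ 0) (hS : S.Valid P)
    (u : Fin Ku) (θ : Demand K Ku) :
    S.residual u θ ∅ ≤ ∑ n, entropy (S.law P) (S.ans n) := by
  refine (entropy_pi_sub_le (S.lawGiven θ) (fun n x => S.answer n (x.2 n) x.1)
    (fun x => (x.2, S.cache u x.1, restrict ∅ x.1))).trans (Finset.sum_le_sum fun n _ => ?_)
  rw [S.entropy_ans_eq hP hS.isPrivate n θ]
  have := entropy_prod_le (S.lawGiven θ) (fun x => S.answer n (x.2 n) x.1)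
    (fun x => (x.2, S.cache u x.1, restrict ∅ x.1))
  linarith

/-- Submodularity of the knowledge. -/
theorem knowledge_insert_sub_le (u : Fin Ku) (i k : Fin K) (T : Finset (Fin K)) :
    S.knowledge u (insert k (insert i T)) - S.knowledge u (insert i T)
      ≤ S.knowledge u (insert k T) - S.knowledge u T := by
  have h := entropy_add_entropy_le (PMF.uniformOfFintype (Library K S.Bit)) (fun W => W k)
    (fun W => W i) (fun W => (S.cache u W, restrict T W))
  have h1 : ∀ k, S.knowledge u (insert k T)
      = entropy (PMF.uniformOfFintype (Library K S.Bit))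
        (fun W => (W k, S.cache u W, restrict T W)) := fun k => by
    rw [knowledge]
    exact entropy_congr _ fun _ _ => by simp only [Prod.mk.injEq, restrict_insert_eq_iff]; tauto
  have h2 : S.knowledge u (insert k (insert i T))
      = entropy (PMF.uniformOfFintype (Library K S.Bit))
        (fun W => (W k, W i, S.cache u W, restrict T W)) := by
    rw [knowledge]
    exact entropy_congr _ fun _ _ => by simp only [Prod.mk.injEq, restrict_insert_eq_iff]; tauto
  rw [h1 k, h1 i, h2]
  simp only [knowledge]
  linarith

theorem sub_le_knowledge_univ_sub (hL : 0 < S.length) (u : Fin Ku) :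
    (K - S.memory u) * S.length ≤ S.knowledge u Finset.univ - S.knowledge u ∅ := by
  have hL' : (0 : ℝ) < S.length := by exact_mod_cast hL
  have h1 : S.knowledge u ∅ ≤ S.memory u * S.length := by
    rw [memory, div_mul_cancel₀ _ hL'.ne']
    refine le_trans (entropy_mono _ fun W W' h => ?_)
      (entropy_le_logb_card (PMF.uniformOfFintype (Library K S.Bit)) (S.cache u))
    exact Prod.ext h ((restrict_eq_iff ∅ W W').2 (by simp))
  have h2 : (K : ℝ) * S.length ≤ S.knowledge u Finset.univ := by
    have h3 : Real.logb 2 (Fintype.card (Library K S.Bit)) = K * S.length := by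
      rw [Fintype.card_pi_const, Fintype.card_fun, ZMod.card, length]
      push_cast
      rw [Real.logb_pow, Real.logb_pow, Real.logb_self_eq_one one_lt_two, mul_one]
    rw [← h3, ← entropy_uniformOfFintype]
    refine entropy_mono _ fun W W' h => funext fun k => ?_
    exact (restrict_eq_iff _ _ _).1 (Prod.mk.inj h).2 k (Finset.mem_univ k)
  rw [sub_mul]
  linarith

/-- The chain of the converse, for one order of the messages. -/
theorem sum_knowledge_le {P : PMF (Demand K Ku)} (hP : ∀ θ, P θ ≠ 0) (hS : S.Valid P) (hN : 0 < N)
    (u : Fin Ku) (s : ℕ → Fin K) (m : ℕ) :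
    ∑ j ∈ Finset.range m, (S.knowledge u ((Finset.range (j + 1)).image s)
        - S.knowledge u ((Finset.range j).image s)) * (1 / (N : ℝ) ^ j)
      ≤ ∑ n, entropy (S.law P) (S.ans n) := by
  have hN' : (0 : ℝ) < N := by exact_mod_cast hN
  -- The induction has to carry the residual that is still unspent, already with the next message `s
  -- m` as the demand.
  suffices h : ∑ j ∈ Finset.range m, (S.knowledge u ((Finset.range (j + 1)).image s)
        - S.knowledge u ((Finset.range j).image s)) * (1 / (N : ℝ) ^ j)
      + S.residual u (fun _ => s m) ((Finset.range m).image s) * (1 / (N : ℝ) ^ m)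
      ≤ ∑ n, entropy (S.law P) (S.ans n) by
    have := mul_nonneg (S.residual_nonneg u (fun _ => s m) ((Finset.range m).image s))
      (by positivity : (0 : ℝ) ≤ 1 / (N : ℝ) ^ m)
    linarith
  induction m with
  | zero => simpa using S.residual_empty_le hP hS u fun _ => s 0
  | succ m ih =>
    refine le_trans ?_ ih
    have h1 := S.residual_eq hP hS u (fun _ => s m) ((Finset.range m).image s)
    have h2 := S.residual_le_mul hP hS u (fun _ => s m) (fun _ => s (m + 1))
      ((Finset.range (m + 1)).image s)
    rw [Finset.sum_range_succ, h1, ← Finset.image_insert, ← Finset.range_add_one]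
    have h3 := mul_le_mul_of_nonneg_right h2 (by positivity : (0 : ℝ) ≤ 1 / (N : ℝ) ^ (m + 1))
    have h4 : N * S.residual u (fun _ => s m) ((Finset.range (m + 1)).image s)
        * (1 / (N : ℝ) ^ (m + 1))
        = S.residual u (fun _ => s m) ((Finset.range (m + 1)).image s) * (1 / (N : ℝ) ^ m) := by
      rw [pow_succ]; field_simp
    rw [h4] at h3
    linarith

/-- The load of any scheme is at least the single-user bound. -/
theorem le_load {P : PMF (Demand K Ku)} (hP : ∀ θ, P θ ≠ 0) (hS : S.Valid P) (hN : 0 < N)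
    (hK : 0 < K) (u : Fin Ku) : (1 - S.memory u / K) * pirLoad N K ≤ S.load P := by
  have hL : (0 : ℝ) < S.length := by exact_mod_cast hS.length_pos
  have hK' : (0 : ℝ) < K := by exact_mod_cast hK
  set s : ℕ → Fin K := fun r => ⟨r % K, Nat.mod_lt _ hK⟩ with hs
  -- The cyclic interval of `j` messages starting at `i`; `d i j` is what its next message adds.
  set I : ℕ → ℕ → Finset (Fin K) := fun i j => (Finset.range j).image fun r => s (i + r) with hI
  set d : ℕ → ℕ → ℝ := fun i j => S.knowledge u (I i (j + 1)) - S.knowledge u (I i j) with hd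
  set H : ℝ := ∑ n, entropy (S.law P) (S.ans n) with hH
  have hIzero : ∀ i, I i 0 = ∅ := fun i => by simp [hI]
  have hIperiod : ∀ j, I K j = I 0 j := fun j => by simp [hI, hs]
  have hIuniv : ∀ i, I i K = Finset.univ := by
    intro i
    refine Finset.eq_univ_of_card _ ?_
    rw [Finset.card_image_of_injOn, Finset.card_range, Fintype.card_fin]
    intro a ha b hb hab
    have h1 : i + a ≡ i + b [MOD K] := Fin.mk.inj hab
    have h2 := Nat.ModEq.add_left_cancel' i h1
    exact Nat.ModEq.eq_of_lt_of_lt h2 (Finset.mem_range.1 ha) (Finset.mem_range.1 hb)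
  have hIsucc : ∀ i j, I i (j + 1) = insert (s (i + j)) (I i j) := fun i j => by
    simp [hI, Finset.range_add_one]
  have hIcons : ∀ i j, I i (j + 1) = insert (s i) (I (i + 1) j) := fun i j => by
    induction j with
    | zero => simp [hI]
    | succ j ih =>
      rw [hIsucc, ih, hIsucc (i + 1) j, Finset.insert_comm, show i + 1 + j = i + (j + 1) by ring]
  -- Both sides add the same message; on the right the first message `s i` of the interval is not
  -- yet known.
  have hdle : ∀ i j, d i (j + 1) ≤ d (i + 1) j := by
    intro i j
    have := S.knowledge_insert_sub_le u (s i) (s (i + (j + 1))) (I (i + 1) j)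
    rw [← hIcons i j, ← hIsucc i (j + 1), show i + (j + 1) = i + 1 + j by ring,
      ← hIsucc (i + 1) j] at this
    exact this
  have hanti : Antitone fun j => ∑ i ∈ Finset.range K, d i j := by
    refine antitone_nat_of_succ_le fun j => ?_
    have h1 : ∑ i ∈ Finset.range K, d (i + 1) j = ∑ i ∈ Finset.range K, d i j := by
      have h2 := Finset.sum_range_succ (fun i => d i j) K
      rw [Finset.sum_range_succ'] at h2
      have h3 : d K j = d 0 j := by simp only [hd, hIperiod]
      linarith
    exact (Finset.sum_le_sum fun i _ => hdle i j).trans h1.le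
  have hweight : Antitone fun j : ℕ => 1 / (N : ℝ) ^ j := by
    refine antitone_nat_of_succ_le fun j => one_div_le_one_div_of_le (by positivity) ?_
    exact pow_le_pow_right₀ (by exact_mod_cast hN) (Nat.le_succ j)
  -- Chebyshev's sum inequality for two decreasing sequences.
  have hcheb := (hanti.monovary hweight).monovaryOn (Finset.range K)
    |>.sum_mul_sum_le_card_mul_sum
  have htotal : ∑ j ∈ Finset.range K, ∑ i ∈ Finset.range K, d i j
      = K * (S.knowledge u Finset.univ - S.knowledge u ∅) := by
    rw [Finset.sum_comm]
    have h1 : ∀ i, ∑ j ∈ Finset.range K, d i j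
        = S.knowledge u Finset.univ - S.knowledge u ∅ := fun i => by
      rw [Finset.sum_range_sub fun j => S.knowledge u (I i j), hIuniv, hIzero]
    simp only [h1, Finset.sum_const, Finset.card_range, nsmul_eq_mul]
  have hchain : ∑ j ∈ Finset.range K, (∑ i ∈ Finset.range K, d i j) * (1 / (N : ℝ) ^ j)
      ≤ K * H := by
    simp_rw [Finset.sum_mul]
    rw [Finset.sum_comm]
    refine (Finset.sum_le_sum fun i _ =>
      S.sum_knowledge_le hP hS hN u (fun r => s (i + r)) K).trans ?_
    simp [hH]
  rw [htotal, Finset.card_range] at hcheb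
  have hbound := S.sub_le_knowledge_univ_sub hS.length_pos u
  have hpir : 0 ≤ pirLoad N K := Finset.sum_nonneg fun j _ => by positivity
  rw [load, le_div_iff₀ hL]
  refine le_of_mul_le_mul_left ?_ (mul_pos hK' hK')
  calc (K : ℝ) * K * ((1 - S.memory u / K) * pirLoad N K * S.length)
      = K * ((K - S.memory u) * S.length) * pirLoad N K := by field_simp
    _ ≤ K * (S.knowledge u Finset.univ - S.knowledge u ∅) * pirLoad N K := by gcongr
    _ ≤ K * (K * H) := hcheb.trans (by gcongr)
    _ = K * K * H := by ring

end Scheme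

/-! ### The Sun-Jafar scheme -/

section SunJafar

variable {N K : ℕ}

theorem sumLabel_ext {l l' : SumLabel N K} (h1 : l.1.1 = l'.1.1)
    (h2 : (l.2 : ℕ) = (l'.2 : ℕ)) : l = l' := by
  obtain ⟨⟨T, hT⟩, j⟩ := l
  obtain ⟨⟨T', hT'⟩, j'⟩ := l'
  dsimp only at h1
  subst h1
  have : j = j' := Fin.ext h2
  rw [this]

theorem slot_ext {k : Fin K} {x y : Slot N K k} (h0 : (x.1.1 : ℕ) = y.1.1)
    (h1 : x.1.2.1.1 = y.1.2.1.1) (h2 : (x.1.2.2 : ℕ) = y.1.2.2) : x = y :=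
  Subtype.ext (Prod.ext (Fin.ext h0) (sumLabel_ext h1 h2))

variable {θ : Fin K} {n : Fin N} {l : SumLabel N K} {k : Fin K}

theorem sjSlot_fresh (hk : k ∈ l.1.1) (h : ¬(θ ∈ l.1.1 ∧ k ≠ θ)) :
    sjSlot θ n l k hk = ⟨(n, l), hk⟩ := by
  rw [sjSlot, dif_neg h]

theorem sjSlot_side (hk : k ∈ l.1.1) (h : θ ∈ l.1.1 ∧ k ≠ θ) :
    ((sjSlot θ n l k hk).1.1 : ℕ) = (n + 1 + l.2 % (N - 1)) % N ∧
      (sjSlot θ n l k hk).1.2.1.1 = l.1.1.erase θ ∧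
      ((sjSlot θ n l k hk).1.2.2 : ℕ) = l.2 / (N - 1) := by
  rw [sjSlot, dif_pos h]
  exact ⟨rfl, rfl, rfl⟩

theorem side_database_ne (hN : 2 ≤ N) (n : Fin N) (j : ℕ) :
    (n + 1 + j % (N - 1)) % N ≠ n := by
  intro h
  have hr : j % (N - 1) < N - 1 := Nat.mod_lt _ (by omega)
  have h1 : (n : ℕ) + (1 + j % (N - 1)) ≡ n + 0 [MOD N] := by
    rw [Nat.ModEq, add_zero, Nat.mod_eq_of_lt n.isLt, ← add_assoc, h]
  have h2 := Nat.ModEq.eq_of_lt_of_lt (Nat.ModEq.add_left_cancel' _ h1) (by omega) (by omega)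
  omega

/-- Fresh places belong to database `n`, side places to other databases. A side place gives back its
sum: the database encodes the remainder modulo `N - 1` of the index, and the new index is the
quotient. So no database is asked for a bit twice. -/
theorem sjSlot_injective (hN : 2 ≤ N) (θ : Fin K) (n : Fin N) (k : Fin K) :
    Function.Injective fun l : {l : SumLabel N K // k ∈ l.1.1} => sjSlot θ n l.1 k l.2 := by
  rintro ⟨l, hl⟩ ⟨l', hl'⟩ h
  dsimp only at h
  rw [Subtype.mk.injEq]
  by_cases c : θ ∈ l.1.1 ∧ k ≠ θ
  · obtain ⟨a0, a1, a2⟩ := sjSlot_side (n := n) hl c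
    by_cases c' : θ ∈ l'.1.1 ∧ k ≠ θ
    · obtain ⟨b0, b1, b2⟩ := sjSlot_side (n := n) hl' c'
      rw [h] at a0 a1 a2
      refine sumLabel_ext ?_ ?_
      · rw [← Finset.insert_erase c.1, ← Finset.insert_erase c'.1, ← a1, ← b1]
      · have hr : (l.2 : ℕ) % (N - 1) < N - 1 := Nat.mod_lt _ (by omega)
        have hr' : (l'.2 : ℕ) % (N - 1) < N - 1 := Nat.mod_lt _ (by omega)
        have h1 : (l.2 : ℕ) % (N - 1) ≡ (l'.2 : ℕ) % (N - 1) [MOD N] :=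
          Nat.ModEq.add_left_cancel' (n + 1) (a0.symm.trans b0)
        have h2 := Nat.ModEq.eq_of_lt_of_lt h1 (by omega) (by omega)
        rw [← Nat.div_add_mod (l.2 : ℕ) (N - 1), ← Nat.div_add_mod (l'.2 : ℕ) (N - 1), ← a2, ← b2,
          h2]
    · rw [h, sjSlot_fresh hl' c'] at a0
      exact absurd a0.symm (side_database_ne hN n _)
  · rw [sjSlot_fresh hl c] at h
    by_cases c' : θ ∈ l'.1.1 ∧ k ≠ θ
    · obtain ⟨b0, -, -⟩ := sjSlot_side (n := n) hl' c'
      rw [← h] at b0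
      exact absurd b0.symm (side_database_ne hN n _)
    · rw [sjSlot_fresh hl' c'] at h
      exact (Prod.mk.inj (Subtype.mk.inj h)).2

/-- The side information in a sum with the wanted message forms a sum of another database. -/
theorem exists_side_sum (n : Fin N) (hθ : θ ∈ l.1.1) (hne : (l.1.1.erase θ).Nonempty) :
    ∃ (n' : Fin N) (l' : SumLabel N K), l'.1.1 = l.1.1.erase θ ∧
      ∀ k (hk : k ∈ l.1.1) (hk' : k ∈ l'.1.1), sjSlot θ n l k hk = sjSlot θ n' l' k hk' := by
  obtain ⟨k₀, hk₀⟩ := hne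
  have hk₀' := Finset.mem_erase.1 hk₀
  obtain ⟨a0, a1, a2⟩ := sjSlot_side (n := n) hk₀'.2 ⟨hθ, hk₀'.1⟩
  refine ⟨(sjSlot θ n l k₀ hk₀'.2).1.1, _, a1, fun k hk hk' => ?_⟩
  have hkθ : k ≠ θ := Finset.ne_of_mem_erase (a1 ▸ hk')
  obtain ⟨b0, b1, b2⟩ := sjSlot_side (n := n) hk ⟨hθ, hkθ⟩
  rw [sjSlot_fresh hk' fun h => Finset.notMem_erase θ l.1.1 (a1 ▸ h.1)]
  exact slot_ext (b0.trans a0.symm) (b1.trans a1.symm) (b2.trans a2.symm)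

/-- The bijection between the two ranges extends to all of the finite set `β`. -/
theorem exists_perm_apply_eq {α β : Type} [Finite β] {f g : α → β} (hf : Function.Injective f)
    (hg : Function.Injective g) : ∃ τ : Equiv.Perm β, ∀ a, τ (f a) = g a := by
  classical
  have := Fintype.ofFinite β
  let e : {b // b ∈ Set.range f} ≃ {b // b ∈ Set.range g} :=
    (Equiv.ofInjective f hf).symm.trans (Equiv.ofInjective g hg)
  refine ⟨e.extendSubtype, fun a => ?_⟩
  rw [Equiv.extendSubtype_apply_of_mem e (f a) ⟨a, rfl⟩]
  change ((Equiv.ofInjective g hg ((Equiv.ofInjective f hf).symm (Equiv.ofInjective f hf a)) :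
    Set.range g) : β) = g a
  rw [Equiv.symm_apply_apply, Equiv.ofInjective_apply]

theorem uniformOfFintype_map_equiv {α : Type} [Fintype α] [Nonempty α] (e : α ≃ α) :
    (PMF.uniformOfFintype α).map e = PMF.uniformOfFintype α := by
  ext b
  rw [PMF.map_apply, tsum_eq_single (e.symm b)]
  · simp
  · intro a ha
    rw [if_neg]
    rintro rfl
    simp at ha

/-- The binomial theorem for `((N - 1) + 1) ^ K`; the empty set of messages, which labels no sum,
gives the summand `1`. -/
theorem sub_one_mul_card_sumLabel (hN : 1 ≤ N) :
    (N - 1) * Fintype.card (SumLabel N K) + 1 = N ^ K := by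
  classical
  have h1 := Fintype.sum_pow_mul_eq_add_pow (Fin K) (N - 1) 1
  simp only [one_pow, mul_one, Nat.sub_add_cancel hN, Fintype.card_fin] at h1
  rw [← h1, Fintype.card_sigma, Finset.mul_sum,
    ← Finset.add_sum_erase _ _ (Finset.mem_univ (∅ : Finset (Fin K))), add_comm,
    Finset.card_empty, pow_zero, add_right_inj]
  rw [Finset.sum_subtype (p := fun T : Finset (Fin K) => T.Nonempty) (Finset.univ.erase ∅)
    (by simp [Finset.nonempty_iff_ne_empty]) (fun T => (N - 1) ^ T.card)]
  refine Finset.sum_congr rfl fun T _ => ?_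
  rw [Fintype.card_fin, ← pow_succ', Nat.sub_add_cancel (Finset.card_pos.2 T.2)]

theorem sub_one_mul_pirLoad (hN : 1 ≤ N) (K : ℕ) :
    ((N : ℝ) - 1) * (N ^ K * pirLoad N K) = N * ((N : ℝ) ^ K - 1) := by
  have hN' : (N : ℝ) ≠ 0 := by positivity
  induction K with
  | zero => simp [pirLoad]
  | succ K ih =>
    have h : pirLoad N (K + 1) = pirLoad N K + 1 / (N : ℝ) ^ K := Finset.sum_range_succ _ _
    have h2 : (N : ℝ) ^ (K + 1) * (1 / (N : ℝ) ^ K) = N := by rw [pow_succ]; field_simp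
    rw [h, mul_add, h2, pow_succ]
    linear_combination (N : ℝ) * ih

/-- The download of the Sun-Jafar scheme for messages of `N ^ K` bits. Multiplied by `N - 1`, both
sides become `N (N ^ K - 1)`. -/
theorem card_sumLabel (hN : 2 ≤ N) (K : ℕ) :
    (N : ℝ) * Fintype.card (SumLabel N K) = N ^ K * pirLoad N K := by
  have h1 : ((N : ℝ) - 1) * Fintype.card (SumLabel N K) + 1 = (N : ℝ) ^ K := by
    have h := sub_one_mul_card_sumLabel (K := K) (by omega : 1 ≤ N)
    rw [← Nat.cast_pow, ← h]
    push_cast [Nat.cast_sub (by omega : 1 ≤ N)]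
    ring
  have h2 := sub_one_mul_pirLoad (by omega : 1 ≤ N) K
  have h3 : (N : ℝ) - 1 ≠ 0 := by
    have : (2 : ℝ) ≤ N := by exact_mod_cast hN
    linarith
  refine mul_left_cancel₀ h3 ?_
  rw [h2]
  linear_combination (N : ℝ) * h1

end SunJafar

/-! ### The product design is a valid scheme -/

section Validity

variable {N K Ku : ℕ} (m : Fin (Ku + 1) → ℕ)

/-- For each user and message, a permutation of the places carries the injective pattern of `θ'` to
that of `θ`. Composing the enumerations with these permutations preserves their uniform law. -/
theorem map_pdQuery_eq (hN : 2 ≤ N) (n : Fin N) (θ θ' : Demand K Ku) :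
    (PMF.uniformOfFintype (PDKey N K Ku m)).map (fun π => pdQuery N K Ku m θ π n)
      = (PMF.uniformOfFintype (PDKey N K Ku m)).map (fun π => pdQuery N K Ku m θ' π n) := by
  have h : ∀ (u : Fin Ku) (k : Fin K), ∃ τ : Equiv.Perm (Slot N K k),
      ∀ l : {l : SumLabel N K // k ∈ l.1.1},
        τ (sjSlot (θ' u) n l.1 k l.2) = sjSlot (θ u) n l.1 k l.2 := fun u k =>
    exists_perm_apply_eq (sjSlot_injective hN (θ' u) n k) (sjSlot_injective hN (θ u) n k)
  choose τ hτ using h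
  let e : PDKey N K Ku m ≃ PDKey N K Ku m :=
    Equiv.piCongrRight fun _ => Equiv.piCongrRight fun u => Equiv.piCongrRight fun k =>
      Equiv.equivCongr (τ u.1 k).symm (Equiv.refl _)
  have he : (fun π => pdQuery N K Ku m θ π n) = (fun π => pdQuery N K Ku m θ' π n) ∘ e := by
    funext π c u l k
    have := hτ u.1 k.1 ⟨l, k.2⟩
    simp only [pdQuery, Function.comp_apply, e, Equiv.piCongrRight_apply, Pi.map_apply,
      Equiv.equivCongr_apply_apply, Equiv.symm_symm, Equiv.refl_apply]
    rw [← this]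
  rw [he, ← PMF.map_comp, uniformOfFintype_map_equiv]

theorem productDesign_private (hN : 2 ≤ N) {P : PMF (Demand K Ku)} (hP : ∀ θ, P θ ≠ 0) :
    (productDesign N K Ku m).Private P := by
  refine ((productDesign N K Ku m).private_iff hP).2 fun n θ θ' => ?_
  have h : ∀ θ, ((productDesign N K Ku m).lawGiven θ).map (fun x => (x.1, x.2 n))
      = compound (PMF.uniformOfFintype (Library K (productDesign N K Ku m).Bit)) fun _ =>
        (PMF.uniformOfFintype (PDKey N K Ku m)).map (fun π => pdQuery N K Ku m θ π n) := by
    intro θ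
    refine (compound_map_prod (β := Fin N → PDQuery N K Ku m) _ _ fun q => q n).trans ?_
    congr 1
    funext W
    exact PMF.map_comp _ _ _
  rw [h θ, h θ', map_pdQuery_eq m hN n θ θ']

/-- The answer of database `n` in the Sun-Jafar scheme of user `u` for the packets that she wants
from `c`. -/
def sjAnswer (θ : Demand K Ku) (π : PDKey N K Ku m) (W : Library K (PDBit N K Ku m))
    (c : Coded Ku m) (u : {u // u ∈ c.2.1}) (n : Fin N) (l : SumLabel N K) : ZMod 2 :=
  ∑ k : {k // k ∈ l.1.1}, W k.1 (wantedPacket c u, pdQuery N K Ku m θ π n c u l k)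

variable {m} in
/-- A user can cancel what the other users want from a coded message. -/
theorem sjAnswer_eq_of_answer_eq {θ : Demand K Ku} {π : PDKey N K Ku m}
    {W W' : Library K (PDBit N K Ku m)} {c : Coded Ku m} (u : {u // u ∈ c.2.1}) {n : Fin N}
    {l : SumLabel N K}
    (hcache : ∀ k (b : PDBit N K Ku m), u.1 ∈ b.1.2.1 → W k b = W' k b)
    (hans : ∑ u, sjAnswer m θ π W c u n l = ∑ u, sjAnswer m θ π W' c u n l) :
    sjAnswer m θ π W c u n l = sjAnswer m θ π W' c u n l := by
  classical
  rw [← Finset.add_sum_erase _ _ (Finset.mem_univ u),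
    ← Finset.add_sum_erase (a := u) _ (fun u => sjAnswer m θ π W' c u n l) (Finset.mem_univ u)]
    at hans
  refine (add_left_inj _).1 (hans.trans ?_)
  congr 1
  refine Finset.sum_congr rfl fun u' hu' => Finset.sum_congr rfl fun k _ => ?_
  refine (hcache _ _ (Finset.mem_erase.2 ⟨fun h => ?_, u.2⟩)).symm
  exact Finset.ne_of_mem_erase hu' (Subtype.ext h.symm)

variable {m} in
/-- Correctness of the Sun-Jafar scheme. -/
theorem eq_of_sjAnswer_eq {θ : Demand K Ku} {π : PDKey N K Ku m}
    {W W' : Library K (PDBit N K Ku m)} {c : Coded Ku m} {u : {u // u ∈ c.2.1}}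
    (h : ∀ n l, sjAnswer m θ π W c u n l = sjAnswer m θ π W' c u n l)
    (i : Fin (N ^ K)) :
    W (θ u.1) (wantedPacket c u, i) = W' (θ u.1) (wantedPacket c u, i) := by
  classical
  -- Every bit of the wanted packet has a place, and there it is the fresh bit of sum `l` of
  -- database `n`.
  obtain ⟨⟨⟨n, l⟩, hk⟩, rfl⟩ := (π c u (θ u.1)).surjective i
  dsimp only at hk
  let F : Library K (PDBit N K Ku m) → Fin N → SumLabel N K → Fin K → ZMod 2 := fun W n l k =>
    if hk : k ∈ l.1.1 then W k (wantedPacket c u, π c u k (sjSlot (θ u.1) n l k hk)) else 0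
  have hF : ∀ W n l, sjAnswer m θ π W c u n l = ∑ k ∈ l.1.1, F W n l k := by
    intro W n l
    rw [← Finset.sum_coe_sort]
    refine Finset.sum_congr rfl fun k _ => ?_
    simp only [F]
    rw [dif_pos k.2]
    rfl
  have hside : ∑ k ∈ l.1.1.erase (θ u.1), F W n l k = ∑ k ∈ l.1.1.erase (θ u.1), F W' n l k := by
    rcases Finset.eq_empty_or_nonempty (l.1.1.erase (θ u.1)) with he | hne
    · rw [he, Finset.sum_empty, Finset.sum_empty]
    · obtain ⟨n', l', hl', hs⟩ := exists_side_sum n hk hne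
      have h1 : ∀ W, ∑ k ∈ l.1.1.erase (θ u.1), F W n l k = sjAnswer m θ π W c u n' l' := by
        intro W
        rw [hF, hl']
        refine Finset.sum_congr rfl fun k hk => ?_
        have hk1 := Finset.mem_of_mem_erase hk
        have hk2 : k ∈ l'.1.1 := hl' ▸ hk
        simp only [F]
        rw [dif_pos hk1, dif_pos hk2, hs k hk1 hk2]
      rw [h1, h1, h]
  have h2 := h n l
  rw [hF, hF, ← Finset.add_sum_erase _ _ hk, ← Finset.add_sum_erase _ _ hk, hside,
    add_left_inj] at h2
  simp only [F] at h2
  rw [dif_pos hk, dif_pos hk, sjSlot_fresh hk fun h => h.2 rfl] at h2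
  exact h2

theorem productDesign_decodable {P : PMF (Demand K Ku)} (hP : ∀ θ, P θ ≠ 0) :
    (productDesign N K Ku m).Decodable P := by
  classical
  refine ((productDesign N K Ku m).decodable_iff hP).2 fun u θ => ?_
  rintro ⟨W, q⟩ ⟨W', q'⟩ hx - heq
  simp only [Prod.mk.injEq] at heq
  obtain ⟨rfl, hans, hcache⟩ := heq
  have hq := ((compound_ne_zero_iff _ _ _ _).1 hx).2
  -- The two outcomes have the same queries, so one key `π` serves for both libraries.
  obtain ⟨π, -, rfl⟩ := (PMF.mem_support_map_iff _ _ _).1 ((PMF.mem_support_iff _ _).2 hq)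
  have hc : ∀ k (b : PDBit N K Ku m), u ∈ b.1.2.1 → W k b = W' k b := fun k b hb =>
    congrFun hcache ⟨(k, b), hb⟩
  funext ⟨⟨b, T⟩, i⟩
  by_cases hu : u ∈ T.1
  · exact hc _ _ hu
  · have hcard : (insert u T.1).card = (b.1 : ℕ) + 1 := by
      rw [Finset.card_insert_of_notMem hu, T.2]
    -- An uncached packet is the one user `u` wants from the coded message for the users in `T` and
    -- herself.
    let c : Coded Ku m := ⟨b, insert u T.1, hcard⟩
    have hw : wantedPacket c ⟨u, Finset.mem_insert_self u T.1⟩ = ⟨b, T⟩ := by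
      have : (⟨(insert u T.1).erase u, by rw [Finset.erase_insert hu, T.2]⟩ :
          {T : Finset (Fin Ku) // T.card = (b.1 : ℕ)}) = T :=
        Subtype.ext (Finset.erase_insert hu)
      exact congrArg (Sigma.mk b) this
    have key := eq_of_sjAnswer_eq (θ := θ) (π := π) (W := W) (W' := W')
      (u := ⟨u, Finset.mem_insert_self u T.1⟩)
      (fun n l => sjAnswer_eq_of_answer_eq (c := c) ⟨u, Finset.mem_insert_self u T.1⟩ hc
        (congrFun (congrFun (congrFun hans n) c) l)) i
    rw [hw] at key
    exact key

theorem productDesign_valid (hN : 2 ≤ N) {P : PMF (Demand K Ku)} (hP : ∀ θ, P θ ≠ 0)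
    (hL : 0 < (productDesign N K Ku m).length) : (productDesign N K Ku m).Valid P where
  length_pos := hL
  queries := fun _ _ _ _ _ => rfl
  decodable := productDesign_decodable m hP
  isPrivate := productDesign_private m hN hP

end Validity

/-! ### Memory and load of the product design -/

section Sizes

variable {N K Ku : ℕ} (m : Fin (Ku + 1) → ℕ)

theorem card_packet : Fintype.card (Packet Ku m) = ∑ t, m t * Ku.choose t := by
  rw [Fintype.card_sigma, Fintype.sum_sigma]
  simp

theorem card_coded : Fintype.card (Coded Ku m) = ∑ t, m t * Ku.choose (t + 1) := by
  rw [Fintype.card_sigma, Fintype.sum_sigma]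
  simp

theorem length_productDesign :
    (productDesign N K Ku m).length = (∑ t, m t * Ku.choose t) * N ^ K := by
  refine (Fintype.card_prod (Packet Ku m) (Fin (N ^ K))).trans ?_
  rw [card_packet, Fintype.card_fin]

theorem sum_notMem_eq_choose (u : Fin Ku) (t : ℕ) :
    ∑ T : {T : Finset (Fin Ku) // T.card = t}, (if u ∈ T.1 then 0 else 1) = (Ku - 1).choose t := by
  classical
  rw [← Finset.sum_subtype (Finset.univ.filter fun T : Finset (Fin Ku) => T.card = t) (by simp)
    (fun T => if u ∈ T then 0 else 1)]
  have h : (Finset.univ.erase u).card = Ku - 1 := by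
    rw [Finset.card_erase_of_mem (Finset.mem_univ u), Finset.card_univ, Fintype.card_fin]
  rw [← h, ← Finset.card_powersetCard, Finset.card_eq_sum_ones]
  simp_rw [← ite_not (u ∈ _)]
  rw [← Finset.sum_filter]
  refine Finset.sum_congr (Finset.ext fun T => ?_) fun _ _ => rfl
  simp [Finset.mem_powersetCard, Finset.subset_erase, and_comm]

/-- The packets that `u` does not store are counted, one for each `t`-subset of the other users; the
additive form avoids natural subtraction. -/
theorem card_cacheCell_add (u : Fin Ku) :
    Fintype.card (CacheCell N K Ku m u) + K * ((∑ t, m t * (Ku - 1).choose t) * N ^ K)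
      = K * ((∑ t, m t * Ku.choose t) * N ^ K) := by
  classical
  have h1 : Fintype.card (CacheCell N K Ku m u)
      = K * ((∑ p : Packet Ku m, if u ∈ p.2.1 then 1 else 0) * N ^ K) := by
    have e : CacheCell N K Ku m u ≃ Fin K × {p : Packet Ku m // u ∈ p.2.1} × Fin (N ^ K) :=
      { toFun := fun x => (x.1.1, ⟨x.1.2.1, x.2⟩, x.1.2.2)
        invFun := fun y => ⟨(y.1, y.2.1.1, y.2.2), y.2.1.2⟩
        left_inv := fun _ => rfl
        right_inv := fun _ => rfl }
    rw [Fintype.card_congr e, Fintype.card_prod, Fintype.card_prod, Fintype.card_fin,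
      Fintype.card_fin, Fintype.card_subtype, Finset.card_filter]
  have h2 : ∑ p : Packet Ku m, (if u ∈ p.2.1 then 0 else 1) = ∑ t, m t * (Ku - 1).choose t := by
    rw [Fintype.sum_sigma, Fintype.sum_sigma]
    simp_rw [sum_notMem_eq_choose]
    simp
  have h3 : ∑ p : Packet Ku m, (if u ∈ p.2.1 then 1 else 0)
      + ∑ p : Packet Ku m, (if u ∈ p.2.1 then 0 else 1) = ∑ t, m t * Ku.choose t := by
    rw [← card_packet, ← Finset.sum_add_distrib, ← Finset.card_univ, Finset.card_eq_sum_ones]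
    refine Finset.sum_congr rfl fun p _ => ?_
    split_ifs <;> rfl
  rw [h1, ← h2, ← h3]
  ring

theorem memory_productDesign (hL : 0 < (productDesign N K Ku m).length) (u : Fin Ku) :
    (productDesign N K Ku m).memory u
      = K * (1 - ((∑ t, m t * (Ku - 1).choose t : ℕ) : ℝ) / (∑ t, m t * Ku.choose t : ℕ)) := by
  have h0 : Real.logb 2 (Fintype.card ((productDesign N K Ku m).Cache u))
      = Fintype.card (CacheCell N K Ku m u) := by
    rw [show Fintype.card ((productDesign N K Ku m).Cache u)
        = 2 ^ Fintype.card (CacheCell N K Ku m u) from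
        Fintype.card_fun.trans (by rw [ZMod.card]), Nat.cast_pow, Real.logb_pow, Nat.cast_ofNat,
      Real.logb_self_eq_one one_lt_two, mul_one]
  rw [Scheme.memory, h0]
  rw [length_productDesign] at hL ⊢
  have h1 := congrArg (Nat.cast (R := ℝ)) (card_cacheCell_add (N := N) (K := K) m u)
  have h2 : ((∑ t, m t * Ku.choose t : ℕ) : ℝ) ≠ 0 := by
    exact_mod_cast (Nat.pos_of_mul_pos_right hL).ne'
  have h3 : ((N ^ K : ℕ) : ℝ) ≠ 0 := by exact_mod_cast (Nat.pos_of_mul_pos_left hL).ne'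
  rw [Nat.cast_add, Nat.cast_mul, Nat.cast_mul, Nat.cast_mul, Nat.cast_mul] at h1
  rw [Nat.cast_mul, eq_sub_of_add_eq h1]
  field_simp

/-- Answer entropies are bounded by the alphabet size only; where equality is needed, the converse
supplies the other inequality. -/
theorem load_productDesign_le (hN : 2 ≤ N) (P : PMF (Demand K Ku)) :
    (productDesign N K Ku m).load P
      ≤ ((∑ t, m t * Ku.choose (t + 1) : ℕ) : ℝ) / (∑ t, m t * Ku.choose t : ℕ) * pirLoad N K := by
  have h0 : ∀ n, entropy ((productDesign N K Ku m).law P) ((productDesign N K Ku m).ans n)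
      ≤ (∑ t, m t * Ku.choose (t + 1) : ℕ) * Fintype.card (SumLabel N K) := by
    intro n
    refine (entropy_le_logb_card _ _).trans (le_of_eq ?_)
    have h1 : Fintype.card (productDesign N K Ku m).Answer
        = (2 ^ Fintype.card (SumLabel N K)) ^ Fintype.card (Coded Ku m) :=
      Fintype.card_fun.trans (by rw [Fintype.card_fun, ZMod.card])
    rw [h1, card_coded, Nat.cast_pow, Real.logb_pow, Nat.cast_pow, Real.logb_pow, Nat.cast_ofNat,
      Real.logb_self_eq_one one_lt_two, mul_one]
  have hN' : (0 : ℝ) < (N : ℝ) ^ K := by positivity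
  rw [Scheme.load, length_productDesign]
  calc _ ≤ (∑ _n : Fin N, ((∑ t, m t * Ku.choose (t + 1) : ℕ) : ℝ) * Fintype.card (SumLabel N K))
        / ((∑ t, m t * Ku.choose t) * N ^ K : ℕ) := by
        gcongr with n; exact h0 n
    _ = (∑ t, m t * Ku.choose (t + 1) : ℕ) * (N * Fintype.card (SumLabel N K))
        / ((∑ t, m t * Ku.choose t : ℕ) * (N : ℝ) ^ K) := by
        rw [Finset.sum_const, Finset.card_univ, Fintype.card_fin, nsmul_eq_mul]
        push_cast
        ring
    _ = _ := by
        rw [card_sumLabel hN]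
        field_simp

end Sizes

/-! ### ### Optimality in the range of large memory -/

/-- Memory sharing between the two largest parameters: `a` blocks with parameter `κ` and `b` blocks
with parameter `κ + 1`, for `κ + 1` users. -/
def topBlocks (κ a b : ℕ) (t : Fin (κ + 1 + 1)) : ℕ :=
  if (t : ℕ) = κ + 1 then b else if (t : ℕ) = κ then a else 0

theorem sum_topBlocks_mul (κ a b : ℕ) (f : ℕ → ℕ) :
    ∑ t, topBlocks κ a b t * f t = a * f κ + b * f (κ + 1) := by
  rw [Fin.sum_univ_castSucc, Fin.sum_univ_castSucc, Finset.sum_eq_zero, zero_add]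
  · simp [topBlocks]
  · intro i _
    have := i.isLt
    rw [topBlocks, if_neg (by simp; omega), if_neg (by simp; omega), zero_mul]

/-- For `M` such that `1 - M / K` is the rational number `a / q`, memory sharing attains the
single-user bound. -/
theorem productDesign_topBlocks {N K κ : ℕ} (hN : 2 ≤ N) (hK : 1 ≤ K)
    {P : PMF (Demand K (κ + 1))} (hP : ∀ θ, P θ ≠ 0) {a q : ℕ} (hq : 0 < q)
    (haq : a * (κ + 1) ≤ q) {M : ℝ} (hM : 1 - M / K = a / q) :
    (productDesign N K (κ + 1) (topBlocks κ a (q - a * (κ + 1)))).Valid P ∧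
    (∀ u, (productDesign N K (κ + 1) (topBlocks κ a (q - a * (κ + 1)))).memory u = M) ∧
    (productDesign N K (κ + 1) (topBlocks κ a (q - a * (κ + 1)))).load P
      = (1 - M / K) * pirLoad N K := by
  have hK' : (K : ℝ) ≠ 0 := by positivity
  -- A block with parameter `κ` has `κ + 1` packets, one of them missing at each user, and one coded
  -- message. A block with parameter `κ + 1` is a single packet, stored by everybody. So of `q`
  -- packets each user lacks `a`, and `a` coded messages are sent.
  have s1 : ∑ t, topBlocks κ a (q - a * (κ + 1)) t * (κ + 1).choose t = q := by
    rw [sum_topBlocks_mul κ a _ fun t => (κ + 1).choose t, Nat.choose_succ_self_right,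
      Nat.choose_self, mul_one]
    omega
  have s2 : ∑ t, topBlocks κ a (q - a * (κ + 1)) t * (κ + 1).choose (t + 1) = a := by
    rw [sum_topBlocks_mul κ a _ fun t => (κ + 1).choose (t + 1), Nat.choose_self,
      Nat.choose_succ_self]
    omega
  have s3 : ∑ t, topBlocks κ a (q - a * (κ + 1)) t * (κ + 1 - 1).choose t = a := by
    rw [sum_topBlocks_mul κ a _ fun t => (κ + 1 - 1).choose t, Nat.add_sub_cancel, Nat.choose_self,
      Nat.choose_succ_self]
    omega
  have hL : 0 < (productDesign N K (κ + 1) (topBlocks κ a (q - a * (κ + 1)))).length := by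
    rw [length_productDesign, s1]
    positivity
  have hvalid := productDesign_valid _ hN hP hL
  have hmem : ∀ u, (productDesign N K (κ + 1) (topBlocks κ a (q - a * (κ + 1)))).memory u = M := by
    intro u
    rw [memory_productDesign _ hL, s1, s3, ← hM]
    field_simp
    ring
  refine ⟨hvalid, hmem, le_antisymm ?_ ?_⟩
  · refine (load_productDesign_le _ hN P).trans_eq ?_
    rw [s1, s2, hM]
  · have := Scheme.le_load _ hP hvalid (by omega) hK 0
    rwa [hmem] at this

theorem pirLoad_nonneg (N K : ℕ) : 0 ≤ pirLoad N K :=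
  Finset.sum_nonneg fun _ _ => by positivity

theorem pirLoad_le {N : ℕ} (hN : 1 ≤ N) (K : ℕ) : pirLoad N K ≤ K := by
  refine (Finset.sum_le_card_nsmul (Finset.range K) _ 1 fun i _ => ?_).trans (by simp)
  rw [div_le_one (by positivity)]
  exact one_le_pow₀ (by exact_mod_cast hN)

/-- The single-user line passes through the last two corner points and lies below the others. It
also lies below the uncoded load, since `pirLoad N K ≤ K`. -/
theorem productDesignLoad_eq {N K κ : ℕ} (hN : 1 ≤ N) (hK : 1 ≤ K) {M : ℝ}
    (hM : (K : ℝ) * (((κ + 1 : ℕ) : ℝ) - 1) / (κ + 1 : ℕ) ≤ M) (hM' : M ≤ K) :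
    productDesignLoad N K (κ + 1) M = (1 - M / K) * pirLoad N K := by
  have hK' : (0 : ℝ) < K := by exact_mod_cast hK
  have hx : 0 ≤ 1 - M / K := by rw [sub_nonneg, div_le_one hK']; exact hM'
  have hx' : (κ + 1) * (1 - M / K) ≤ 1 := by
    rw [div_le_iff₀ (by positivity)] at hM
    push_cast at hM
    have : (K : ℝ) * ((κ + 1) * (1 - M / K)) ≤ K * 1 := by
      field_simp
      linarith
    exact le_of_mul_le_mul_left this hK'
  have henv : envelopeLoad N K (κ + 1) M = (1 - M / K) * pirLoad N K := by
    refine IsLeast.csInf_eq ⟨?_, ?_⟩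
    -- These weights on the last two corners have mean memory `M`; the lower bound on `M` is what
    -- makes the first one nonnegative.
    · refine ⟨fun t => if (t : ℕ) = κ + 1 then 1 - (κ + 1) * (1 - M / K)
        else if (t : ℕ) = κ then (κ + 1) * (1 - M / K) else 0, ⟨fun t => ?_, ?_⟩, ?_, ?_⟩
      · dsimp only
        split_ifs
        · linarith
        · positivity
        · exact le_rfl
      all_goals
        rw [Fin.sum_univ_castSucc, Fin.sum_univ_castSucc, Finset.sum_eq_zero, zero_add]
        rotate_left
        · intro i _
          have := i.isLt
          simp only [Fin.val_castSucc]
          rw [if_neg (by omega), if_neg (by omega)]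
          try rw [zero_mul]
      · simp
      · simp
        field_simp
        ring
      · simp [cornerLoad]
        field_simp
    · rintro R ⟨c, ⟨hc0, hc1⟩, hcM, rfl⟩
      have h1 : (1 - M / K) * pirLoad N K
          = ∑ t : Fin (κ + 1 + 1), c t * ((1 - (t : ℕ) / ((κ + 1 : ℕ) : ℝ)) * pirLoad N K) := by
        have h2 : M / K = ∑ t : Fin (κ + 1 + 1), c t * ((t : ℕ) / ((κ + 1 : ℕ) : ℝ)) := by
          rw [← hcM, Finset.sum_div]
          refine Finset.sum_congr rfl fun t _ => ?_
          field_simp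
        rw [h2]
        conv_lhs => rw [← hc1, ← Finset.sum_sub_distrib, Finset.sum_mul]
        exact Finset.sum_congr rfl fun t _ => by ring
      rw [h1]
      refine Finset.sum_le_sum fun t _ => mul_le_mul_of_nonneg_left ?_ (hc0 t)
      refine mul_le_mul_of_nonneg_right ?_ (pirLoad_nonneg N K)
      have ht : (t : ℕ) ≤ κ + 1 := Nat.lt_succ_iff.1 t.isLt
      have h3 : (1 : ℝ) - (t : ℕ) / ((κ + 1 : ℕ) : ℝ)
          = (((κ + 1 : ℕ) : ℝ) - (t : ℕ)) / ((κ + 1 : ℕ) : ℝ) := by field_simp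
      rw [h3]
      -- At `t = κ + 1` both sides vanish; otherwise `t + 1 ≤ κ + 1` and the corner has the smaller
      -- denominator.
      rcases ht.eq_or_lt with h | h
      · rw [h]; simp
      · have h4 : ((t : ℕ) : ℝ) + 1 ≤ ((κ + 1 : ℕ) : ℝ) := by exact_mod_cast h
        refine div_le_div_of_nonneg_left (by linarith) (by positivity) h4
  rw [productDesignLoad, henv, min_eq_right]
  rw [mul_comm (K : ℝ)]
  exact mul_le_mul_of_nonneg_left (pirLoad_le hN K) hx

/-- The product design attains the single-user bound at rational memory sizes. -/
theorem exists_productDesign_of_rat {N K κ : ℕ} (hN : 2 ≤ N) (hK : 1 ≤ K)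
    {P : PMF (Demand K (κ + 1))} (hP : ∀ θ, P θ ≠ 0) {r : ℚ}
    (hr : (K : ℝ) * (((κ + 1 : ℕ) : ℝ) - 1) / (κ + 1 : ℕ) ≤ r) (hr' : (r : ℝ) ≤ K) :
    ∃ m : Fin (κ + 1 + 1) → ℕ, (productDesign N K (κ + 1) m).Valid P ∧
      (∀ u, (productDesign N K (κ + 1) m).memory u = r) ∧
      (productDesign N K (κ + 1) m).load P = (1 - r / K) * pirLoad N K := by
  have hK' : (0 : ℝ) < K := by exact_mod_cast hK
  obtain ⟨x, hx⟩ : ∃ x : ℚ, x = 1 - r / K := ⟨_, rfl⟩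
  have hxR : (x : ℝ) = 1 - r / K := by rw [hx]; push_cast; ring
  have hx0 : 0 ≤ x := by
    have : (0 : ℝ) ≤ x := by rw [hxR, sub_nonneg, div_le_one hK']; exact hr'
    exact_mod_cast this
  have hxeq : (x : ℝ) = x.num.toNat / x.den := by
    have h1 : ((x.num.toNat : ℤ) : ℝ) = x.num := by rw [Int.toNat_of_nonneg (Rat.num_nonneg.2 hx0)]
    rw [← Int.cast_natCast (R := ℝ) x.num.toNat, h1]
    exact Rat.cast_def x
  have hden : (0 : ℝ) < x.den := by exact_mod_cast x.den_pos
  refine ⟨_, productDesign_topBlocks hN hK hP x.den_pos ?_ (hxR.symm.trans hxeq)⟩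
  have h2 : (x : ℝ) * (κ + 1) ≤ 1 := by
    rw [div_le_iff₀ (by positivity)] at hr
    push_cast at hr
    rw [hxR]
    refine le_of_mul_le_mul_left ?_ hK'
    field_simp
    linarith
  rw [hxeq, div_mul_eq_mul_div, div_le_one hden] at h2
  exact_mod_cast h2

/-- The product design attains the single-user bound up to any `ε > 0`. -/
theorem exists_productDesign_of_pos {N K κ : ℕ} (hN : 2 ≤ N) (hK : 1 ≤ K)
    {P : PMF (Demand K (κ + 1))} (hP : ∀ θ, P θ ≠ 0) {M : ℝ}
    (hM : (K : ℝ) * (((κ + 1 : ℕ) : ℝ) - 1) / (κ + 1 : ℕ) ≤ M) (hM' : M ≤ K) {ε : ℝ} (hε : 0 < ε) :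
    ∃ m : Fin (κ + 1 + 1) → ℕ, (productDesign N K (κ + 1) m).Valid P ∧
      (∀ u, (productDesign N K (κ + 1) m).memory u ≤ M) ∧
      (productDesign N K (κ + 1) m).load P ≤ (1 - M / K) * pirLoad N K + ε := by
  have hK' : (0 : ℝ) < K := by exact_mod_cast hK
  obtain ⟨r, hr, hrM, hrε⟩ : ∃ r : ℚ,
      (K : ℝ) * (((κ + 1 : ℕ) : ℝ) - 1) / (κ + 1 : ℕ) ≤ r ∧ (r : ℝ) ≤ M ∧ M - r ≤ ε := by
    -- The left endpoint is itself rational; above it a rational just below `M` is taken, and the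
    -- load grows by at most `M - r`.
    rcases hM.eq_or_lt with h | h
    · refine ⟨(K : ℚ) * (((κ + 1 : ℕ) : ℚ) - 1) / (κ + 1 : ℕ), ?_, ?_, ?_⟩
      · push_cast; exact le_rfl
      · rw [← h]; push_cast; exact le_rfl
      · rw [← h]; push_cast; rw [sub_self]; exact hε.le
    · obtain ⟨r, h1, h2⟩ := exists_rat_btwn (max_lt h (sub_lt_self M hε))
      rw [max_lt_iff] at h1
      exact ⟨r, h1.1.le, h2.le, by linarith⟩
  obtain ⟨m, hv, hm, hl⟩ := exists_productDesign_of_rat hN hK hP hr (hrM.trans hM')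
  refine ⟨m, hv, fun u => (hm u).trans_le hrM, hl.trans_le ?_⟩
  have h1 : (M - r) / K * pirLoad N K ≤ ε := by
    have : (M - r) / K * pirLoad N K ≤ (M - r) / K * K :=
      mul_le_mul_of_nonneg_left (pirLoad_le (by omega) K) (div_nonneg (by linarith) hK'.le)
    rw [div_mul_cancel₀ _ hK'.ne'] at this
    linarith
  have h2 : (1 - (r : ℝ) / K) * pirLoad N K
      = (1 - M / K) * pirLoad N K + (M - r) / K * pirLoad N K := by ring
  linarith

end MuPIR

end

theorem corollary3 (N K Ku : ℕ) (hN : 2 ≤ N) (hK : 1 ≤ K) (hKu : 1 ≤ Ku)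
    (P : PMF (MuPIR.Demand K Ku)) (hP : ∀ θ, P θ ≠ 0)
    (M : ℝ) (hM : (K : ℝ) * ((Ku : ℝ) - 1) / Ku ≤ M) (hM' : M ≤ K) :
    -- the load of the product design is the minimal achievable load
    IsGLB {R : ℝ | MuPIR.Achievable N P M R} (MuPIR.productDesignLoad N K Ku M) ∧
    -- it equals the single-user bound
    MuPIR.productDesignLoad N K Ku M
      = (1 - M / K) * ∑ i ∈ Finset.range K, 1 / (N : ℝ) ^ i ∧
    -- the product design attains it exactly if `M` is rational,
    ((∃ r : ℚ, (r : ℝ) = M) → ∃ m : Fin (Ku + 1) → ℕ,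
      (MuPIR.productDesign N K Ku m).Valid P ∧
      (∀ u, (MuPIR.productDesign N K Ku m).memory u = M) ∧
      (MuPIR.productDesign N K Ku m).load P = MuPIR.productDesignLoad N K Ku M) ∧
    -- and up to any `ε > 0` in general
    (∀ ε : ℝ, 0 < ε → ∃ m : Fin (Ku + 1) → ℕ,
      (MuPIR.productDesign N K Ku m).Valid P ∧
      (∀ u, (MuPIR.productDesign N K Ku m).memory u ≤ M) ∧
      (MuPIR.productDesign N K Ku m).load P ≤ MuPIR.productDesignLoad N K Ku M + ε) := by
  obtain ⟨κ, rfl⟩ : ∃ κ, Ku = κ + 1 := ⟨Ku - 1, by omega⟩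
  have hload := MuPIR.productDesignLoad_eq (N := N) (by omega) hK hM hM'
  have hnear := fun (ε : ℝ) (hε : 0 < ε) =>
    MuPIR.exists_productDesign_of_pos hN hK hP hM hM' hε
  have hK' : (0 : ℝ) < K := by exact_mod_cast hK
  rw [hload]
  -- The near-optimal instances suffice for the infimum, so irrational `M` needs no separate
  -- treatment.
  refine ⟨⟨?_, fun B hB => le_of_forall_pos_le_add fun ε hε => ?_⟩, rfl, ?_, hnear⟩
  · rintro R ⟨S, hS, hmem, hR⟩
    refine le_trans ?_ ((S.le_load hP hS (by omega) hK 0).trans hR)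
    refine mul_le_mul_of_nonneg_right ?_ (MuPIR.pirLoad_nonneg N K)
    exact sub_le_sub_left (div_le_div_of_nonneg_right (hmem 0) hK'.le) 1
  · obtain ⟨m, hv, hm, hl⟩ := hnear ε hε
    exact hB ⟨_, hv, hm, hl⟩
  · rintro ⟨r, rfl⟩
    exact MuPIR.exists_productDesign_of_rat hN hK hP hM hM'
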